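/- Let $n\ge 2$. For $t\in\mathbb R$ let $e^{it\Delta}$ be the free Schrödinger propagator on $L^2(\mathbb R^n)$, and for $z\in\mathbb C\setminus\mathbb R$ let $R_0(z)=(-\Delta-z)^{-1}$ be the free resolvent on $L^2(\mathbb R^n)$. For a measurable weight $w:\mathbb R^n\to[0,\infty]$ put $$\|f\|_{L^2(w)}^2=\int_{\mathbb R^n}|f(x)|^2w(x)\,dx,\qquad \|F\|_{L^2_{t,x}(w)}^2=\int_{\mathbb R}\int_{\mathbb R^n}|F(x,t)|^2w(x)\,dx\,dt,$$ with the convention $0\cdot\infty=0$; the weight $|V|^{-1}$ is $\infty$ where $V=0$. There is a constant $C$, depending only on $n$, such that the following holds. Let $V:\mathbb R^n\to\mathbb C$ be measurable, let $0\le C(V)<\infty$, and suppose that the resolvent estimate $$\|R_0(z)f\|_{L^2(|V|)}\le C(V)\,\|f\|_{L^2(|V|^{-1})}\qquad\text{for all } f\in L^2\cap L^2(|V|^{-1})$$ holds uniformly in $z\in\mathbb C\setminus\mathbb R$. Then: 1. for every $f\in L^2(\mathbb R^n)$, $$\big\|e^{it\Delta}f\big\|_{L^2_{t,x}(|V|)}\le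 C\,C(V)^{1/2}\|f\|_2;$$ 2. for every $F\in L^2_{t,x}(|V|^{-1})$ the integral $\int_{-\infty}^\infty e^{-is\Delta}F(\cdot,s)\,ds$ exists in $L^2(\mathbb R^n)$ and $$\Big\|\int_{-\infty}^\infty e^{-is\Delta}F(\cdot,s)\,ds\Big\|_2\le C\,C(V)^{1/2}\|F\|_{L^2_{t,x}(|V|^{-1})};$$ 3. for every $F\in L^2_{t,x}(|V|^{-1})$ the integral $\int_0^te^{i(t-s)\Delta}F(\cdot,s)\,ds$ exists in $L^2(\mathbb R^n)$ for every $t\in\mathbb R$ and $$\Big\|\int_0^te^{i(t-s)\Delta}F(\cdot,s)\,ds\Big\|_{L^2_{t,x}(|V|)}\le C\,C(V)\,\|F\|_{L^2_{t,x}(|V|^{-1})}.$$ Here the integrals in 2 and 3 are weak integrals in $L^2(\mathbb R^n)$: for an interval $I$ with endpoints in $[-\infty,\infty]$ and $t\in\mathbb R$, $u=\int_Ie^{i(t-s)\Delta}F(\cdot,s)\,ds$ means that $u\in L^2(\mathbb R^n)$ and $$\int_{\mathbb R^n}u\,\overline g\,dx=\int_I\int_{\mathbb R^n}F(x,s)\,\overline{\big(e^{i(s-t)\Delta}g\big)(x)}\,dx\,ds\qquad\text{for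 all } g\in L^2(\mathbb R^n),$$ where the inner integral converges absolutely for almost every $s\in I$ and the outer one converges absolutely; for $t<0$, $\int_0^t=-\int_t^0$. -/

import Mathlib

open MeasureTheory Set
open scoped ENNReal NNReal FourierTransform ComplexConjugate

noncomputable section

namespace WeightedStrichartz

/-- The complex Hilbert space `L²(ℝⁿ)`. -/
abbrev L2 (n : ℕ) : Type :=
  Lp (α := EuclideanSpace ℝ (Fin n)) ℂ 2 volume

/-- The Fourier multiplier `f ↦ 𝓕⁻¹ (m · 𝓕 f)` on `L²(ℝⁿ)` with essentially bounded symbol `m`.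
Here `𝓕 f (ξ) = ∫ exp (-2 π i ⟨x, ξ⟩) f x dx` is extended to `L²` by Plancherel's theorem. -/
def multiplier {n : ℕ} (m : EuclideanSpace ℝ (Fin n) → ℂ) (hm : MemLp m ∞ volume) (f : L2 n) :
    L2 n :=
  𝓕⁻ (hm.toLp m • 𝓕 f : L2 n)

/-- The symbol of `-Δ`; with the normalization of `𝓕` above it is `4 π² |ξ|²`. -/
def laplaceSymbol {n : ℕ} (ξ : EuclideanSpace ℝ (Fin n)) : ℝ :=
  (2 * Real.pi * ‖ξ‖) ^ 2

theorem continuous_laplaceSymbol {n : ℕ} : Continuous (laplaceSymbol (n := n)) := by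
  unfold laplaceSymbol
  fun_prop

theorem memLp_propagatorSymbol (n : ℕ) (t : ℝ) :
    MemLp (fun ξ : EuclideanSpace ℝ (Fin n) =>
      Complex.exp (-(Complex.I * (t * laplaceSymbol ξ : ℝ)))) ∞ volume := by
  refine memLp_top_of_bound (C := 1) ?_ (Filter.Eventually.of_forall fun ξ => ?_)
  · have := continuous_laplaceSymbol (n := n)
    exact Continuous.aestronglyMeasurable (by fun_prop)
  · rw [Complex.norm_exp]
    simp

/-- The free Schrödinger propagator `e^{itΔ}` on `L²(ℝⁿ)`. -/
def propagator {n : ℕ} (t : ℝ) (f : L2 n) : L2 n :=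
  multiplier _ (memLp_propagatorSymbol n t) f

theorem memLp_resolventSymbol (n : ℕ) (z : ℂ) (hz : z.im ≠ 0) :
    MemLp (fun ξ : EuclideanSpace ℝ (Fin n) => ((laplaceSymbol ξ : ℂ) - z)⁻¹) ∞ volume := by
  refine memLp_top_of_bound (C := |z.im|⁻¹) ?_ (Filter.Eventually.of_forall fun ξ => ?_)
  · have := continuous_laplaceSymbol (n := n)
    refine Continuous.aestronglyMeasurable (Continuous.inv₀ (by fun_prop) fun ξ h => hz ?_)
    have := congrArg Complex.im h
    simpa using this
  · rw [norm_inv]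
    refine inv_anti₀ (abs_pos.2 hz) ?_
    have := Complex.abs_im_le_norm ((laplaceSymbol ξ : ℂ) - z)
    simpa using this

/-- The free resolvent `R₀(z) = (-Δ - z)⁻¹` on `L²(ℝⁿ)`, for `z ∈ ℂ \ ℝ`. -/
def freeResolvent {n : ℕ} (z : ℂ) (hz : z.im ≠ 0) (f : L2 n) : L2 n :=
  multiplier _ (memLp_resolventSymbol n z hz) f

/-- The norm of `L²(w) = L²(w dx)` for a weight `w : ℝⁿ → [0, ∞]`. As usual `0 · ∞ = 0`, so that
finiteness of the norm forces `f = 0` almost everywhere on `{w = ∞}`. -/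
def weightedNorm {n : ℕ} (w : EuclideanSpace ℝ (Fin n) → ℝ≥0∞)
    (f : EuclideanSpace ℝ (Fin n) → ℂ) : ℝ≥0∞ :=
  (∫⁻ x, ‖f x‖ₑ ^ 2 * w x) ^ (1 / 2 : ℝ)

/-- The norm of `L²_{t,x}(w)` for a weight `w` in the space variable:
`(∫ ‖F(t)‖_{L²(w)}² dt)^{1/2}`. -/
def spaceTimeNorm {n : ℕ} (w : EuclideanSpace ℝ (Fin n) → ℝ≥0∞)
    (F : ℝ → EuclideanSpace ℝ (Fin n) → ℂ) : ℝ≥0∞ :=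
  (∫⁻ t, weightedNorm w (F t) ^ 2) ^ (1 / 2 : ℝ)

/-- The weight `|V|`. -/
def absWeight {n : ℕ} (V : EuclideanSpace ℝ (Fin n) → ℂ) : EuclideanSpace ℝ (Fin n) → ℝ≥0∞ :=
  fun x => ‖V x‖ₑ

/-- The weight `|V|⁻¹`, equal to `∞` where `V` vanishes. -/
def invWeight {n : ℕ} (V : EuclideanSpace ℝ (Fin n) → ℂ) : EuclideanSpace ℝ (Fin n) → ℝ≥0∞ :=
  fun x => ‖V x‖ₑ⁻¹

/-- The resolvent estimate `‖R₀(z) f‖_{L²(|V|)} ≤ K ‖f‖_{L²(|V|⁻¹)}`, uniformly in `z ∈ ℂ \ ℝ`,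
for all `f ∈ L² ∩ L²(|V|⁻¹)`. -/
def UniformResolventEstimate {n : ℕ} (V : EuclideanSpace ℝ (Fin n) → ℂ) (K : ℝ≥0) : Prop :=
  ∀ (z : ℂ) (hz : z.im ≠ 0) (f : L2 n), weightedNorm (invWeight V) f < ∞ →
    weightedNorm (absWeight V) (freeResolvent z hz f) ≤ K * weightedNorm (invWeight V) f

/-- `∫ F(x) conj((e^{-iτΔ} g)(x)) dx`, which is `⟨e^{iτΔ} F, g⟩` when `F ∈ L²`
(inner product linear in the first entry). -/
def propagatorPairing {n : ℕ} (τ : ℝ) (F : EuclideanSpace ℝ (Fin n) → ℂ) (g : L2 n) : ℂ :=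
  ∫ x, F x * conj (propagator (-τ) g x)

/-- `u ∈ L²` is the integral `∫_{-∞}^{∞} e^{-isΔ} F(·,s) ds`. For `F` in a weighted space the slices
`F(·,s)` need not lie in `L²`, so the integral is understood weakly, by pairing with every
`g ∈ L²` and moving the unitary group to `g`. The element `u` is determined by `F`. -/
def IsPropagatorIntegral {n : ℕ} (F : ℝ → EuclideanSpace ℝ (Fin n) → ℂ) (u : L2 n) : Prop :=
  ∀ g : L2 n,
    (∀ᵐ s : ℝ, Integrable (fun x => F s x * conj (propagator s g x))) ∧
    Integrable (fun s : ℝ => propagatorPairing (-s) (F s) g) ∧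
    inner ℂ g u = ∫ s : ℝ, propagatorPairing (-s) (F s) g

/-- `u ∈ L²` is the integral `∫_0^t e^{i(t-s)Δ} F(·,s) ds` (an oriented integral, so equal to
`-∫_t^0` for `t < 0`), understood weakly as in `IsPropagatorIntegral`. -/
def IsRetardedIntegral {n : ℕ} (F : ℝ → EuclideanSpace ℝ (Fin n) → ℂ) (t : ℝ) (u : L2 n) : Prop :=
  ∀ g : L2 n,
    (∀ᵐ s : ℝ, s ∈ uIoc 0 t → Integrable (fun x => F s x * conj (propagator (s - t) g x))) ∧
    IntervalIntegrable (fun s : ℝ => propagatorPairing (t - s) (F s) g) volume 0 t ∧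
    inner ℂ g u = ∫ s in (0 : ℝ)..t, propagatorPairing (t - s) (F s) g

end WeightedStrichartz

end

open WeightedStrichartz

noncomputable section

namespace WeightedStrichartz

open Filter Topology

/-! ### Hilbert-valued Plancherel theorem and one-parameter groups of isometries. -/

section

section Plancherel

variable {H : Type*} [NormedAddCommGroup H] [InnerProductSpace ℂ H] [CompleteSpace H]

/-! This is Kato's smoothing theory. Let `U` be the Schrödinger group and `A` the multiplication by
`|V|^{1/2}` cut off to `{|V| ≤ k}`, a bounded symmetric operator. Since `A` maps `L²` into
`L²(|V|⁻¹)` with norm at most one, and `L²(|V|)` into `L²` likewise, the hypothesis gives `‖A R₀(z)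
A‖ ≤ K` uniformly in `z` and `k`.

The resolvent is the Laplace transform of the group. Hence the damped retarded operator `h ↦ A
∫_{s<t} e^{-ε(t-s)} U(t-s) A h(s) ds` is a convolution in time whose Fourier multiplier is, up to a
unimodular factor, `A R₀(z) A` with `z` on a horizontal line. Plancherel in time bounds it by `K`,
and Fatou removes the damping (`Supersmooth.eLpNorm_retarded`). The upper half plane serves `U`, the
lower one the reversed group.

With `T h = ∫ U(-s) A h(s) ds`, the function `A U(t) T h` is a retarded plus an advanced term, so
has norm at most `2K ‖h‖`. The `TT*` argument gives `‖T‖² ≤ 2K`, and the adjoint of `T` is `f ↦ A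
U(t) f`.

It remains to let `k → ∞`. The homogeneous estimate follows by monotone convergence. A forcing term
is written `F = |V|^{1/2} g` with `g ∈ L²(ℝ; L²)`. Its slices may leave `L²`, but their pairings
with an orbit `e^{isΔ} f` are dominated by `‖g(s)‖ ‖e^{isΔ} f‖_{L²(|V|)}`, which is integrable by
the homogeneous estimate. So the regularised integrals converge weakly, and the bounds survive by
lower semicontinuity. -/

theorem continuous_fourier {H : Type*} [NormedAddCommGroup H] [InnerProductSpace ℂ H]
    {f : ℝ → H} (hf : Integrable f) : Continuous (𝓕 f) := by
  change Continuous (VectorFourier.fourierIntegral 𝐞 volume (innerₗ ℝ) f)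
  exact VectorFourier.fourierIntegral_continuous Real.continuous_fourierChar
    (by exact continuous_inner) hf

/-- The Fourier transform on `L²` is given by the Fourier integral on `L¹ ∩ L²`. -/
theorem fourier_toLp_ae_eq {f : ℝ → H} (hf : Integrable f) (hf2 : MemLp f 2) :
    (𝓕 (hf2.toLp f) : Lp (α := ℝ) H 2 volume) =ᵐ[volume] 𝓕 f := by
  -- It suffices to test against smooth compactly supported functions. There the `L²` transform
  -- agrees with the distributional one, which moves onto the test function, and Fubini moves it
  -- back onto `f`.
  refine ae_eq_of_integral_contDiff_smul_eq
    ((Lp.memLp _).locallyIntegrable (by norm_num))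
    (continuous_fourier hf).locallyIntegrable fun g g_smooth g_cpt => ?_
  have hg₁ : HasCompactSupport (Complex.ofRealCLM ∘ g) := g_cpt.comp_left rfl
  have hg₂ : ContDiff ℝ (⊤ : ℕ∞) (Complex.ofRealCLM ∘ g) := by fun_prop
  set φ : SchwartzMap ℝ ℂ := hg₁.toSchwartzMap hg₂ with hφ
  have hφa : ∀ x, φ x = (g x : ℂ) := fun x => rfl
  have key := congrArg (fun T => T φ) (Lp.fourier_toTemperedDistribution_eq (hf2.toLp f))
  simp only [TemperedDistribution.fourier_apply, Lp.toTemperedDistribution_apply] at key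
  have h1 : ∫ x, (𝓕 φ) x • (hf2.toLp f) x = ∫ x, (𝓕 φ) x • f x := by
    refine integral_congr_ae ?_
    filter_upwards [hf2.coeFn_toLp] with x hx
    rw [hx]
  have h2 : ∫ x, (𝓕 φ) x • f x = ∫ x, φ x • (𝓕 f) x := by
    have := VectorFourier.integral_fourierIntegral_smul_eq_flip (e := 𝐞) (μ := volume)
      (ν := volume) (L := innerₗ ℝ) (f := (φ : ℝ → ℂ)) (g := f) Real.continuous_fourierChar
      (by exact continuous_inner) φ.integrable hf
    rw [flip_innerₗ] at this
    rw [SchwartzMap.fourier_coe]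
    exact this
  calc ∫ x, g x • (𝓕 (hf2.toLp f) : Lp (α := ℝ) H 2 volume) x
      = ∫ x, φ x • (𝓕 (hf2.toLp f) : Lp (α := ℝ) H 2 volume) x := by simp [hφa]
    _ = ∫ x, φ x • (𝓕 f) x := by rw [← key, h1, h2]
    _ = _ := by simp [hφa]

/-- Plancherel's theorem for functions with values in a Hilbert space. -/
theorem eLpNorm_fourier_eq {f : ℝ → H} (hf : Integrable f) (hf2 : MemLp f 2) :
    eLpNorm (𝓕 f) 2 = eLpNorm f 2 := by
  rw [← eLpNorm_congr_ae (fourier_toLp_ae_eq hf hf2), ← eLpNorm_congr_ae hf2.coeFn_toLp,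
    ← Lp.enorm_def, ← Lp.enorm_def, ← ofReal_norm, ← ofReal_norm, Lp.norm_fourier_eq]

end Plancherel

/-- A strongly continuous one-parameter group of isometries of a Hilbert space. -/
structure IsometryGroup (H : Type*) [NormedAddCommGroup H] [InnerProductSpace ℂ H] where
  toFun : ℝ → H →ₗᵢ[ℂ] H
  zero_apply : ∀ x, toFun 0 x = x
  add_apply : ∀ s t x, toFun (s + t) x = toFun s (toFun t x)
  continuous_apply : ∀ x, Continuous fun t => toFun t x

namespace IsometryGroup

variable {H : Type*} [NormedAddCommGroup H] [InnerProductSpace ℂ H]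

instance : CoeFun (IsometryGroup H) fun _ => ℝ → H →ₗᵢ[ℂ] H := ⟨toFun⟩

variable (U : IsometryGroup H)

/-- The group run backwards in time. -/
def reverse : IsometryGroup H where
  toFun t := U (-t)
  zero_apply x := by rw [neg_zero, U.zero_apply]
  add_apply s t x := by rw [neg_add, U.add_apply]
  continuous_apply x := (U.continuous_apply x).comp continuous_neg

theorem reverse_apply (t : ℝ) (x : H) : U.reverse t x = U (-t) x := rfl

theorem apply_neg_apply (t : ℝ) (x : H) : U t (U (-t) x) = x := by
  rw [← U.add_apply, add_neg_cancel, U.zero_apply]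

theorem inner_apply_left (t : ℝ) (x y : H) : inner ℂ (U t x) y = inner ℂ x (U (-t) y) := by
  rw [← (U t).inner_map_map x, U.apply_neg_apply]

/-- Isometry upgrades strong continuity to joint continuity, which makes `s ↦ U s (h s)` measurable
for measurable `h`. -/
theorem continuous_uncurry : Continuous (Function.uncurry fun t x => U t x) := by
  refine continuous_iff_continuousAt.2 fun ⟨t, x⟩ => ?_
  rw [ContinuousAt, tendsto_iff_dist_tendsto_zero]
  have h : Tendsto (fun p : ℝ × H => dist p.2 x + dist (U p.1 x) (U t x)) (𝓝 (t, x)) (𝓝 0) := by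
    have : Continuous fun p : ℝ × H => dist p.2 x + dist (U p.1 x) (U t x) :=
      (continuous_snd.dist continuous_const).add
        (((U.continuous_apply x).comp continuous_fst).dist continuous_const)
    simpa using this.tendsto (t, x)
  refine squeeze_zero (fun _ => dist_nonneg) (fun p => ?_) h
  calc dist (U p.1 p.2) (U t x) ≤ dist (U p.1 p.2) (U p.1 x) + dist (U p.1 x) (U t x) :=
        dist_triangle _ _ _
    _ = _ := by rw [(U p.1).dist_map]

end IsometryGroup

end

/-! ### Laplace transforms and the retarded estimate. -/

section

theorem integrableOn_exp_neg_mul {b : ℂ} (hb : 0 < b.re) :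
    IntegrableOn (fun r : ℝ => Complex.exp (-(b * r))) (Ioi 0) := by
  simp_rw [← neg_mul]
  exact integrableOn_exp_mul_complex_Ioi (by simpa using hb) 0

variable {H : Type*} [NormedAddCommGroup H] [InnerProductSpace ℂ H]

/-- The Laplace transform `∫_0^∞ e^{-br} U(r) x dr` of the orbit of `x`. -/
def laplace (U : IsometryGroup H) (b : ℂ) (x : H) : H :=
  ∫ r in Ioi (0 : ℝ), Complex.exp (-(b * r)) • U r x

/-- A bounded operator `A` is supersmooth for `U`, with constant `K`, if `A R(z) A` is bounded by
`K`, where `R` is the resolvent of the generator of `U`, written as a Laplace transform. -/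
def Supersmooth (U : IsometryGroup H) (A : H →L[ℂ] H) (K : ℝ≥0) : Prop :=
  ∀ ε : ℝ, 0 < ε → ∀ (τ : ℝ) (x : H),
    ‖A (laplace U (ε + 2 * Real.pi * τ * Complex.I) (A x))‖ ≤ K * ‖x‖

/-- The damped retarded Duhamel integral `∫_{-∞}^t e^{-ε(t-s)} U(t-s) A h(s) ds`. -/
def retarded (U : IsometryGroup H) (A : H →L[ℂ] H) (ε : ℝ) (h : ℝ → H) (t : ℝ) : H :=
  ∫ r in Ioi (0 : ℝ), (Real.exp (-(ε * r)) : ℂ) • U r (A (h (t - r)))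

variable (U : IsometryGroup H) (A : H →L[ℂ] H)

theorem aestronglyMeasurable_group_apply {α : Type*} [MeasurableSpace α] {μ : Measure α}
    {f : α → ℝ} {g : α → H} (hf : AEStronglyMeasurable f μ) (hg : AEStronglyMeasurable g μ) :
    AEStronglyMeasurable (fun a => U (f a) (g a)) μ :=
  U.continuous_uncurry.comp_aestronglyMeasurable₂ hf hg

/-- Since `U` is isometric, the integrand has the norm of the convolution integrand of `e^{-εr}` on
`r > 0` with `A h`. The damping makes this kernel integrable and justifies Fubini in
`fourier_retarded`. -/
theorem integrable_retarded_integrand {h : ℝ → H} (hh : Integrable h) {ε : ℝ} (hε : 0 < ε) :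
    Integrable (fun p : ℝ × ℝ => (Real.exp (-(ε * p.2)) : ℂ) • U p.2 (A (h (p.1 - p.2))))
      (volume.prod (volume.restrict (Ioi (0 : ℝ)))) := by
  have hk : Integrable (fun r : ℝ => (Real.exp (-(ε * r)) : ℂ)) (volume.restrict (Ioi (0 : ℝ))) := by
    have := exp_neg_integrableOn_Ioi 0 hε
    simp only [neg_mul] at this
    exact Integrable.ofReal this
  have base := hk.convolution_integrand (ContinuousLinearMap.lsmul ℂ ℂ) hh
  have baseA := A.integrable_comp base
  simp only [ContinuousLinearMap.lsmul_apply] at baseA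
  refine Integrable.mono baseA ?_ (Eventually.of_forall fun p => ?_)
  · have := aestronglyMeasurable_group_apply U
      (μ := volume.prod (volume.restrict (Ioi (0 : ℝ)))) (f := fun p : ℝ × ℝ => p.2)
      continuous_snd.aestronglyMeasurable baseA.aestronglyMeasurable
    simpa using this
  · rw [map_smul, norm_smul, norm_smul, (U p.2).norm_map]

theorem norm_retarded_le {h : ℝ → H} (hh : Integrable h) {ε : ℝ} (hε : 0 ≤ ε) (t : ℝ) :
    ‖retarded U A ε h t‖ ≤ ‖A‖ * ∫ s, ‖h s‖ := by
  have hh' : Integrable (fun r => ‖A‖ * ‖h (t - r)‖) := (hh.comp_sub_left t).norm.const_mul _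
  calc ‖retarded U A ε h t‖ ≤ ∫ r in Ioi (0 : ℝ), ‖A‖ * ‖h (t - r)‖ := by
        refine norm_integral_le_of_norm_le hh'.integrableOn ?_
        refine (ae_restrict_mem measurableSet_Ioi).mono fun r hr => ?_
        rw [norm_smul, (U r).norm_map]
        refine (mul_le_mul ?_ (A.le_opNorm _) (norm_nonneg _) zero_le_one).trans_eq (one_mul _)
        rw [Complex.norm_real, Real.norm_eq_abs, Real.abs_exp, Real.exp_le_one_iff]
        exact neg_nonpos.2 (mul_nonneg hε (le_of_lt hr))
    _ ≤ ∫ r, ‖A‖ * ‖h (t - r)‖ :=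
        setIntegral_le_integral hh' (Eventually.of_forall fun r => by positivity)
    _ = ‖A‖ * ∫ s, ‖h s‖ := by
        rw [integral_const_mul, integral_sub_left_eq_self (fun r => ‖h r‖) volume t]

variable [CompleteSpace H]

theorem inner_laplace {b : ℂ} (hb : 0 < b.re) (x y : H) :
    inner ℂ y (laplace U b x) = ∫ r in Ioi (0 : ℝ), Complex.exp (-(b * r)) * inner ℂ y (U r x) := by
  have hint : IntegrableOn (fun r : ℝ => Complex.exp (-(b * r)) • U r x) (Ioi 0) := by
    refine ((integrableOn_exp_neg_mul hb).smul_const x).mono ?_ (Eventually.of_forall fun r => ?_)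
    · have hexpc : Continuous fun r : ℝ => Complex.exp (-(b * r)) := by fun_prop
      exact hexpc.aestronglyMeasurable.smul (U.continuous_apply x).aestronglyMeasurable
    · simp only [norm_smul, LinearIsometry.norm_map, le_refl]
  rw [laplace, ← integral_inner hint]
  simp_rw [inner_smul_right]

/-- The retarded operator is a convolution in time with the operator kernel `e^{-εr} U(r) A` on `r >
0`, so transforming it turns the kernel into its Laplace transform at `b = ε + 2πiτ`. -/
theorem fourier_retarded {h : ℝ → H} (hh : Integrable h) {ε : ℝ} (hε : 0 < ε) (τ : ℝ) :
    𝓕 (retarded U A ε h) τ = laplace U (ε + 2 * Real.pi * τ * Complex.I) (A (𝓕 h τ)) := by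
  have hint := integrable_retarded_integrand U A hh hε
  have hint' : Integrable (fun p : ℝ × ℝ => Real.fourierChar (-(p.1 * τ)) •
      ((Real.exp (-(ε * p.2)) : ℂ) • U p.2 (A (h (p.1 - p.2)))))
      (volume.prod (volume.restrict (Ioi (0 : ℝ)))) := by
    refine hint.mono ?_ (Eventually.of_forall fun p => by simp [Circle.norm_smul])
    have hc : Continuous fun p : ℝ × ℝ => ((Real.fourierChar (-(p.1 * τ)) : Circle) : ℂ) := by
      have := Real.continuous_fourierChar
      fun_prop
    exact hc.aestronglyMeasurable.smul hint.aestronglyMeasurable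
  rw [Real.fourier_real_eq]
  simp only [retarded, laplace]
  have h1 : ∀ t : ℝ, Real.fourierChar (-(t * τ)) • ∫ r in Ioi (0 : ℝ),
      (Real.exp (-(ε * r)) : ℂ) • U r (A (h (t - r))) = ∫ r in Ioi (0 : ℝ),
      Real.fourierChar (-(t * τ)) • ((Real.exp (-(ε * r)) : ℂ) • U r (A (h (t - r)))) :=
    fun t => (integral_smul _ _).symm
  simp_rw [h1]
  rw [integral_integral_swap hint']
  refine integral_congr_ae (Eventually.of_forall fun r => ?_)
  simp only
  set L : H →L[ℂ] H :=
    (Real.exp (-(ε * r)) : ℂ) • ((U r).toContinuousLinearMap ∘L A) with hL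
  have hLa : ∀ x, L x = (Real.exp (-(ε * r)) : ℂ) • U r (A x) := fun x => rfl
  have hi : Integrable fun t : ℝ => Real.fourierChar (-(t * τ)) • h (t - r) := by
    have := (Real.fourierIntegral_convergent_iff (μ := volume) (f := fun t => h (t - r)) τ).2
      (hh.comp_sub_right r)
    simpa [mul_comm] using this
  calc ∫ t : ℝ, Real.fourierChar (-(t * τ)) • ((Real.exp (-(ε * r)) : ℂ) • U r (A (h (t - r))))
      = ∫ t : ℝ, L (Real.fourierChar (-(t * τ)) • h (t - r)) := by
        refine integral_congr_ae (Eventually.of_forall fun t => ?_)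
        simp only [← hLa, Circle.smul_def, map_smul]
    _ = L (∫ t : ℝ, Real.fourierChar (-(t * τ)) • h (t - r)) := L.integral_comp_comm hi
    -- Translating by `r` produces the factor `e^{-2πirτ}` that combines with `e^{-εr}` into
    -- `e^{-br}`.
    _ = L (∫ t : ℝ, Real.fourierChar (-((t + r) * τ)) • h t) := by
        rw [← integral_sub_right_eq_self
          (fun t => Real.fourierChar (-((t + r) * τ)) • h t) r]
        simp
    _ = L (Real.fourierChar (-(r * τ)) • 𝓕 h τ) := by
        rw [Real.fourier_real_eq, Circle.smul_def, ← integral_smul]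
        congr 1
        refine integral_congr_ae (Eventually.of_forall fun t => ?_)
        simp only [← Circle.smul_def, smul_smul, ← AddChar.map_add_eq_mul]
        congr 2
        ring
    _ = _ := by
        rw [Circle.smul_def, map_smul, hLa, smul_smul, Real.fourierChar_apply,
          Complex.ofReal_exp, ← Complex.exp_add]
        congr 2
        push_cast
        ring

omit [CompleteSpace H] in
theorem integrable_retarded {h : ℝ → H} (hh : Integrable h) {ε : ℝ} (hε : 0 < ε) :
    Integrable (retarded U A ε h) :=
  (integrable_retarded_integrand U A hh hε).integral_prod_left

variable {U A}

/-- Plancherel on both sides reduces the estimate to one at each frequency `τ`, which is the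
supersmoothness bound applied to `𝓕 h τ`. -/
theorem Supersmooth.eLpNorm_retarded_pos {K : ℝ≥0} (hK : Supersmooth U A K) {h : ℝ → H}
    (hh : Integrable h) (hh2 : MemLp h 2) {ε : ℝ} (hε : 0 < ε) :
    eLpNorm (fun t => A (retarded U A ε h t)) 2 ≤ K * eLpNorm h 2 := by
  have hw := integrable_retarded U A hh hε
  -- Being integrable and bounded, the retarded integral is square integrable, so Plancherel applies
  -- to it.
  have hw2 : MemLp (retarded U A ε h) 2 := by
    refine (memLp_two_iff_integrable_sq_norm hw.aestronglyMeasurable).2 ?_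
    refine (hw.norm.mul_const (‖A‖ * ∫ s, ‖h s‖)).mono
      (hw.aestronglyMeasurable.norm.pow 2) (Eventually.of_forall fun t => ?_)
    have := norm_retarded_le U A hh hε.le t
    rw [Real.norm_of_nonneg (by positivity), Real.norm_of_nonneg (by positivity), sq]
    gcongr
  have hA := A.integrable_comp hw
  rw [← eLpNorm_fourier_eq hA (A.comp_memLp' hw2), ← eLpNorm_fourier_eq hh hh2]
  refine (eLpNorm_le_mul_eLpNorm_of_ae_le_mul (c := K) (g := 𝓕 h)
    (Eventually.of_forall fun τ => ?_) 2).trans_eq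
    (by simp)
  have : 𝓕 (fun t => A (retarded U A ε h t)) τ = A (𝓕 (retarded U A ε h) τ) := by
    rw [Real.fourier_real_eq, Real.fourier_real_eq, ← A.integral_comp_comm]
    · simp [Circle.smul_def]
    · have := (Real.fourierIntegral_convergent_iff (μ := volume) (f := retarded U A ε h) τ).2 hw
      simpa [mul_comm] using this
  rw [this, fourier_retarded U A hh hε]
  exact hK ε hε τ _

omit [CompleteSpace H] in
variable (U A) in
theorem tendsto_retarded {h : ℝ → H} (hh : Integrable h) (t : ℝ) :
    Tendsto (fun n : ℕ => retarded U A (1 / ((n : ℝ) + 1)) h t) atTop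
      (𝓝 (retarded U A 0 h t)) := by
  refine tendsto_integral_of_dominated_convergence (fun r => ‖A (h (t - r))‖) (fun n => ?_)
    (A.integrable_comp (hh.comp_sub_left t)).norm.integrableOn (fun n => ?_) ?_
  · have h1 : AEStronglyMeasurable (fun r => U r (A (h (t - r))))
        (volume.restrict (Ioi (0 : ℝ))) :=
      aestronglyMeasurable_group_apply U continuous_id.aestronglyMeasurable
        (A.integrable_comp (hh.comp_sub_left t)).aestronglyMeasurable.restrict
    refine AEStronglyMeasurable.smul (Continuous.aestronglyMeasurable (by fun_prop)) h1
  · refine (ae_restrict_mem measurableSet_Ioi).mono fun r hr => ?_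
    rw [norm_smul, (U r).norm_map]
    refine mul_le_of_le_one_left (norm_nonneg _) ?_
    rw [Complex.norm_real, Real.norm_eq_abs, Real.abs_exp, Real.exp_le_one_iff]
    exact neg_nonpos.2 (mul_nonneg Nat.one_div_pos_of_nat.le (le_of_lt hr))
  · refine Eventually.of_forall fun r => ?_
    have hc : Continuous fun ε : ℝ => (Real.exp (-(ε * r)) : ℂ) • U r (A (h (t - r))) := by
      fun_prop
    exact (hc.tendsto 0).comp tendsto_one_div_add_atTop_nhds_zero_nat

omit [CompleteSpace H] in
variable (U A) in
theorem aestronglyMeasurable_retarded {h : ℝ → H} (hh : Integrable h) :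
    AEStronglyMeasurable (retarded U A 0 h) :=
  aestronglyMeasurable_of_tendsto_ae atTop
    (fun _ => (integrable_retarded U A hh Nat.one_div_pos_of_nat).aestronglyMeasurable)
    (Eventually.of_forall (tendsto_retarded U A hh))

/-- Retarded estimate, without damping. -/
theorem Supersmooth.eLpNorm_retarded {K : ℝ≥0} (hK : Supersmooth U A K) {h : ℝ → H}
    (hh : Integrable h) (hh2 : MemLp h 2) :
    eLpNorm (fun t => A (retarded U A 0 h t)) 2 ≤ K * eLpNorm h 2 := by
  have hε : ∀ n : ℕ, 0 < 1 / ((n : ℝ) + 1) := fun n => Nat.one_div_pos_of_nat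
  -- Fatou along `ε = 1/(n+1)`; the bound does not depend on `ε`.
  refine (Lp.eLpNorm_lim_le_liminf_eLpNorm (p := 2)
    (f := fun (n : ℕ) t => A (retarded U A (1 / ((n : ℝ) + 1)) h t))
    (fun n => (A.integrable_comp (integrable_retarded U A hh (hε n))).aestronglyMeasurable) _
    (Eventually.of_forall fun t =>
      (A.continuous.tendsto _).comp (tendsto_retarded U A hh t))).trans ?_
  refine (liminf_le_liminf (Eventually.of_forall fun n =>
    hK.eLpNorm_retarded_pos hh hh2 (hε n))).trans_eq ?_
  simp

end

/-! ### Duhamel integrals, the `TT*` argument and Kato smoothing. -/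

section

theorem enorm_integral_inner_le {α E : Type*} [MeasurableSpace α] {μ : Measure α}
    [NormedAddCommGroup E] [InnerProductSpace ℂ E] {f g : α → E} (hf : MemLp f 2 μ)
    (hg : MemLp g 2 μ) : ‖∫ a, inner ℂ (f a) (g a) ∂μ‖ₑ ≤ eLpNorm f 2 μ * eLpNorm g 2 μ := by
  have : ∫ a, inner ℂ (f a) (g a) ∂μ = inner ℂ (hf.toLp f) (hg.toLp g) := by
    rw [L2.inner_def]
    refine integral_congr_ae ?_
    filter_upwards [hf.coeFn_toLp, hg.coeFn_toLp] with a h1 h2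
    rw [h1, h2]
  rw [this, ← eLpNorm_congr_ae hf.coeFn_toLp, ← eLpNorm_congr_ae hg.coeFn_toLp,
    ← Lp.enorm_def, ← Lp.enorm_def, ← ofReal_norm, ← ofReal_norm, ← ofReal_norm,
    ← ENNReal.ofReal_mul (norm_nonneg _)]
  exact ENNReal.ofReal_le_ofReal (norm_inner_le_norm _ _)

theorem eLpNorm_two_sq {α E : Type*} [MeasurableSpace α] {μ : Measure α} [NormedAddCommGroup E]
    (f : α → E) : eLpNorm f 2 μ ^ 2 = ∫⁻ a, ‖f a‖ₑ ^ 2 ∂μ := by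
  rw [eLpNorm_eq_lintegral_rpow_enorm_toReal two_ne_zero ENNReal.ofNat_ne_top]
  rw [← ENNReal.rpow_natCast, ← ENNReal.rpow_mul]
  simp

theorem enorm_integral_inner_self {α E : Type*} [MeasurableSpace α] {μ : Measure α}
    [NormedAddCommGroup E] [InnerProductSpace ℂ E] {f : α → E} (hf : MemLp f 2 μ) :
    ‖∫ a, inner ℂ (f a) (f a) ∂μ‖ₑ = eLpNorm f 2 μ ^ 2 := by
  have : ∫ a, inner ℂ (f a) (f a) ∂μ = inner ℂ (hf.toLp f) (hf.toLp f) := by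
    rw [L2.inner_def]
    refine integral_congr_ae ?_
    filter_upwards [hf.coeFn_toLp] with a h1
    rw [h1]
  rw [this, ← eLpNorm_congr_ae hf.coeFn_toLp, ← Lp.enorm_def, inner_self_eq_norm_sq_to_K]
  rw [enorm_pow, ← ofReal_norm, ← ofReal_norm]
  simp

variable {H : Type*} [NormedAddCommGroup H] [InnerProductSpace ℂ H]

/-- The Duhamel integral `∫_0^t U(t-s) A h(s) ds`. -/
def duhamel (U : IsometryGroup H) (A : H →L[ℂ] H) (h : ℝ → H) (t : ℝ) : H :=
  ∫ s in (0 : ℝ)..t, U (t - s) (A (h s))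

/-- The integral `∫ U(-s) A h(s) ds` over all times. -/
def groupIntegral (U : IsometryGroup H) (A : H →L[ℂ] H) (h : ℝ → H) : H :=
  ∫ s, U (-s) (A (h s))

/-- After `r = t - s`, cutting the forcing to nonnegative times cuts the half line `r > 0` down to
`(0, t]`. -/
theorem duhamel_eq_retarded (U : IsometryGroup H) (A : H →L[ℂ] H) (h : ℝ → H) {t : ℝ}
    (ht : 0 ≤ t) : duhamel U A h t = retarded U A 0 ((Ici 0).indicator h) t := by
  have h1 := intervalIntegral.integral_comp_sub_left (a := 0) (b := t)
    (fun r => U r (A (h (t - r)))) t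
  simp only [sub_sub_cancel, sub_self, sub_zero] at h1
  have h2 : ∀ r : ℝ, (Real.exp (-(0 * r)) : ℂ) • U r (A ((Ici 0).indicator h (t - r))) =
      (Iic t).indicator (fun r => U r (A (h (t - r)))) r := by
    intro r
    by_cases hr : r ≤ t
    · rw [indicator_of_mem (show t - r ∈ Ici (0 : ℝ) by simpa using hr),
        indicator_of_mem (show r ∈ Iic t from hr)]
      simp
    · rw [indicator_of_notMem (show t - r ∉ Ici (0 : ℝ) by simpa using hr),
        indicator_of_notMem (show r ∉ Iic t from hr)]
      simp
  rw [duhamel, h1, retarded]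
  simp_rw [h2]
  rw [setIntegral_indicator measurableSet_Iic, intervalIntegral.integral_of_le ht, Ioi_inter_Iic]

theorem duhamel_eq_neg_reverse (U : IsometryGroup H) (A : H →L[ℂ] H) (h : ℝ → H) (t : ℝ) :
    duhamel U A h t = -duhamel U.reverse A (fun s => h (-s)) (-t) := by
  have h1 := intervalIntegral.integral_comp_neg (a := 0) (b := -t)
    (fun s => U (t - s) (A (h s)))
  simp only [neg_neg, neg_zero, sub_neg_eq_add] at h1
  rw [duhamel, duhamel, intervalIntegral.integral_symm, ← h1]
  congr 1
  refine intervalIntegral.integral_congr fun s _ => ?_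
  simp only [IsometryGroup.reverse_apply]
  congr 2
  ring

variable {U : IsometryGroup H} {A : H →L[ℂ] H} {K : ℝ≥0}

/-- The integral `∫ U(t-s) A h(s) ds` splits at `s = t`. The future part is a retarded integral for
the reversed group and the reflected forcing. -/
theorem apply_groupIntegral [CompleteSpace H] (U : IsometryGroup H) (A : H →L[ℂ] H) {h : ℝ → H}
    (hh : Integrable h) (t : ℝ) :
    U t (groupIntegral U A h) =
      retarded U A 0 h t + retarded U.reverse A 0 (fun s => h (-s)) (-t) := by
  have hi : ∀ a : ℝ, Integrable fun s => U (a - s) (A (h s)) := fun a =>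
    (A.integrable_comp hh).mono (aestronglyMeasurable_group_apply U
      (Continuous.aestronglyMeasurable (by fun_prop)) (A.integrable_comp hh).aestronglyMeasurable)
      (Eventually.of_forall fun s => by simp)
  have h1 : U t (groupIntegral U A h) = ∫ s, U (t - s) (A (h s)) := by
    rw [groupIntegral]
    have := (U t).toContinuousLinearMap.integral_comp_comm (hi 0)
    simp only [zero_sub, LinearIsometry.coe_toContinuousLinearMap] at this
    rw [← this]
    simp_rw [← U.add_apply, sub_eq_add_neg]
  have hi' : Integrable fun r => U r (A (h (t - r))) := by
    simpa using (hi t).comp_sub_left t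
  rw [h1, ← integral_sub_left_eq_self (fun s => U (t - s) (A (h s))) volume t]
  simp only [sub_sub_cancel]
  rw [← integral_add_compl measurableSet_Ioi hi', compl_Ioi]
  have h2 := integral_comp_neg_Ioi 0 fun r => U r (A (h (t - r)))
  rw [neg_zero] at h2
  rw [← h2]
  simp [retarded, IsometryGroup.reverse_apply, add_comm]

omit [InnerProductSpace ℂ H] in
theorem memLp_comp_neg {h : ℝ → H} {p : ℝ≥0∞} (hh : MemLp h p) : MemLp (fun s => h (-s)) p :=
  hh.comp_measurePreserving (Measure.measurePreserving_neg volume)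

omit [InnerProductSpace ℂ H] in
theorem eLpNorm_comp_neg {h : ℝ → H} (hh : AEStronglyMeasurable h) :
    eLpNorm (fun s => h (-s)) 2 = eLpNorm h 2 :=
  eLpNorm_comp_measurePreserving hh (Measure.measurePreserving_neg volume)

omit [InnerProductSpace ℂ H] in
theorem aestronglyMeasurable_comp_neg {h : ℝ → H} (hh : AEStronglyMeasurable h) :
    AEStronglyMeasurable (fun s => h (-s)) :=
  hh.comp_measurePreserving (Measure.measurePreserving_neg volume)

/-- Identifies the adjoint of `h ↦ groupIntegral U A h` as `f ↦ A (U s f)`, using the symmetry of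
`A`. -/
theorem inner_groupIntegral [CompleteSpace H] (hA : ∀ x y, inner ℂ (A x) y = inner ℂ x (A y))
    {h : ℝ → H} (hh : Integrable h) (f : H) :
    inner ℂ f (groupIntegral U A h) = ∫ s, inner ℂ (A (U s f)) (h s) := by
  have hi : Integrable fun s => U (-s) (A (h s)) :=
    (A.integrable_comp hh).mono (aestronglyMeasurable_group_apply U
      (Continuous.aestronglyMeasurable (by fun_prop)) (A.integrable_comp hh).aestronglyMeasurable)
      (Eventually.of_forall fun s => by simp)
  rw [groupIntegral, ← integral_inner hi]
  refine integral_congr_ae (Eventually.of_forall fun s => ?_)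
  simp only [hA, U.inner_apply_left]

variable [CompleteSpace H]

/-- Positive times are controlled by the group and negative times by its reversal. Each contributes
`K`, whence the factor 2. -/
theorem Supersmooth.eLpNorm_duhamel (hK : Supersmooth U A K) (hK' : Supersmooth U.reverse A K)
    {h : ℝ → H} (hh : Integrable h) (hh2 : MemLp h 2) :
    eLpNorm (fun t => A (duhamel U A h t)) 2 volume ≤ 2 * K * eLpNorm h 2 volume := by
  set h₁ := (Ici (0 : ℝ)).indicator h
  set h₂ := (Ici (0 : ℝ)).indicator fun s => h (-s)
  have hi₁ : Integrable h₁ := hh.indicator measurableSet_Ici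
  have hi₂ : Integrable h₂ := hh.comp_neg.indicator measurableSet_Ici
  set w₁ := fun t => A (retarded U A 0 h₁ t)
  set w₂ := fun t => A (retarded U.reverse A 0 h₂ t)
  have hm₁ : AEStronglyMeasurable w₁ :=
    A.continuous.comp_aestronglyMeasurable (aestronglyMeasurable_retarded U A hi₁)
  have hm₂ : AEStronglyMeasurable w₂ :=
    A.continuous.comp_aestronglyMeasurable (aestronglyMeasurable_retarded U.reverse A hi₂)
  have b₁ : eLpNorm w₁ 2 volume ≤ K * eLpNorm h 2 volume :=
    (hK.eLpNorm_retarded hi₁ (hh2.indicator measurableSet_Ici)).trans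
      (by gcongr; exact eLpNorm_indicator_le h)
  have b₂ : eLpNorm w₂ 2 volume ≤ K * eLpNorm h 2 volume := by
    refine (hK'.eLpNorm_retarded hi₂ ((memLp_comp_neg hh2).indicator measurableSet_Ici)).trans ?_
    rw [← eLpNorm_comp_neg hh2.1]
    gcongr
    exact eLpNorm_indicator_le _
  have hle : ∀ t, ‖A (duhamel U A h t)‖ ≤ ‖(fun t => ‖w₁ t‖ + ‖w₂ (-t)‖) t‖ := by
    intro t
    rw [Real.norm_of_nonneg (by positivity)]
    rcases le_total 0 t with ht | ht
    · rw [duhamel_eq_retarded U A h ht]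
      exact le_add_of_nonneg_right (norm_nonneg _)
    · rw [duhamel_eq_neg_reverse, duhamel_eq_retarded _ A _ (neg_nonneg.2 ht), map_neg, norm_neg]
      exact le_add_of_nonneg_left (norm_nonneg _)
  calc eLpNorm (fun t => A (duhamel U A h t)) 2 volume
      ≤ eLpNorm (fun t => ‖w₁ t‖ + ‖w₂ (-t)‖) 2 volume := eLpNorm_mono hle
    _ ≤ eLpNorm (fun t => ‖w₁ t‖) 2 volume + eLpNorm (fun t => ‖w₂ (-t)‖) 2 volume :=
        eLpNorm_add_le hm₁.norm (aestronglyMeasurable_comp_neg hm₂).norm one_le_two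
    _ ≤ K * eLpNorm h 2 volume + K * eLpNorm h 2 volume := by
        rw [eLpNorm_norm, eLpNorm_norm, eLpNorm_comp_neg hm₂]
        exact add_le_add b₁ b₂
    _ = 2 * K * eLpNorm h 2 volume := by ring

/-- The `TT*` step: `‖T h‖²` is the pairing of `A U(s) T h` with `h`, and `A U(s) T h` is a sum of
two retarded terms of norm at most `K ‖h‖` each. -/
theorem Supersmooth.enorm_groupIntegral_sq (hK : Supersmooth U A K)
    (hK' : Supersmooth U.reverse A K) (hA : ∀ x y, inner ℂ (A x) y = inner ℂ x (A y))
    {h : ℝ → H} (hh : Integrable h) (hh2 : MemLp h 2) :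
    ‖groupIntegral U A h‖ₑ ^ 2 ≤ 2 * K * eLpNorm h 2 volume ^ 2 := by
  set T := groupIntegral U A h with hT
  have hm₁ : AEStronglyMeasurable fun t => A (retarded U A 0 h t) :=
    A.continuous.comp_aestronglyMeasurable (aestronglyMeasurable_retarded U A hh)
  have hm₂ : AEStronglyMeasurable fun t => A (retarded U.reverse A 0 (fun s => h (-s)) t) :=
    A.continuous.comp_aestronglyMeasurable (aestronglyMeasurable_retarded U.reverse A hh.comp_neg)
  have hb : eLpNorm (fun t => A (U t T)) 2 volume ≤ 2 * K * eLpNorm h 2 volume := by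
    have : (fun t => A (U t T)) = (fun t => A (retarded U A 0 h t)) +
        fun t => A (retarded U.reverse A 0 (fun s => h (-s)) (-t)) := by
      ext1 t
      rw [hT, apply_groupIntegral U A hh, map_add, Pi.add_apply]
    rw [this]
    refine (eLpNorm_add_le hm₁ (aestronglyMeasurable_comp_neg hm₂) one_le_two).trans ?_
    rw [eLpNorm_comp_neg hm₂, mul_assoc, two_mul]
    refine add_le_add (hK.eLpNorm_retarded hh hh2) ?_
    rw [← eLpNorm_comp_neg hh2.1]
    exact hK'.eLpNorm_retarded hh.comp_neg (memLp_comp_neg hh2)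
  have hmem : MemLp (fun t => A (U t T)) 2 :=
    ⟨(A.continuous.comp (U.continuous_apply T)).aestronglyMeasurable, hb.trans_lt
      (ENNReal.mul_lt_top (ENNReal.mul_lt_top (by simp) (by simp)) hh2.2)⟩
  calc ‖T‖ₑ ^ 2 = ‖inner ℂ T T‖ₑ := by
        rw [inner_self_eq_norm_sq_to_K, enorm_pow, ← ofReal_norm, ← ofReal_norm]
        simp
    _ = ‖∫ s, inner ℂ (A (U s T)) (h s)‖ₑ := by rw [← inner_groupIntegral hA hh]
    _ ≤ eLpNorm (fun t => A (U t T)) 2 volume * eLpNorm h 2 volume := enorm_integral_inner_le hmem hh2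
    _ ≤ 2 * K * eLpNorm h 2 volume * eLpNorm h 2 volume := by gcongr
    _ = _ := by ring

/-- Kato's smoothing estimate. -/
theorem Supersmooth.eLpNorm_apply_group_sq (hK : Supersmooth U A K)
    (hK' : Supersmooth U.reverse A K) (hA : ∀ x y, inner ℂ (A x) y = inner ℂ x (A y)) (f : H) :
    eLpNorm (fun t => A (U t f)) 2 volume ^ 2 ≤ 2 * K * ‖f‖ₑ ^ 2 := by
  set G := fun t => A (U t f) with hG
  have hGc : Continuous G := A.continuous.comp (U.continuous_apply f)
  -- Truncating the bounded continuous `G` gives a forcing term in `L¹ ∩ L²`, to which the dual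
  -- estimate applies.
  set h : ℕ → ℝ → H := fun N => (Icc (-(N : ℝ)) N).indicator G with hh
  have hN : ∀ N, eLpNorm (h N) 2 volume ^ 2 ≤ 2 * K * ‖f‖ₑ ^ 2 := by
    intro N
    have hi : Integrable (h N) :=
      (hGc.continuousOn.integrableOn_compact isCompact_Icc).integrable_indicator measurableSet_Icc
    have hb : ∀ t, ‖h N t‖ ≤ ‖A‖ * ‖f‖ := fun t =>
      (norm_indicator_le_norm_self _ _).trans ((A.le_opNorm _).trans_eq (by rw [(U t).norm_map]))
    have hm : MemLp (h N) 2 := by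
      refine (memLp_two_iff_integrable_sq_norm hi.aestronglyMeasurable).2 ?_
      refine (hi.norm.mul_const (‖A‖ * ‖f‖)).mono
        (hi.aestronglyMeasurable.norm.pow 2) (Eventually.of_forall fun t => ?_)
      rw [Real.norm_of_nonneg (by positivity), Real.norm_of_nonneg (by positivity), sq]
      gcongr
      exact hb t
    set X := eLpNorm (h N) 2 volume
    have hX : X ≠ ∞ := hm.2.ne
    have h1 : X ^ 2 ≤ ‖f‖ₑ * ‖groupIntegral U A (h N)‖ₑ := by
      rw [← enorm_integral_inner_self hm]
      have : ∫ s, inner ℂ (h N s) (h N s) = inner ℂ f (groupIntegral U A (h N)) := by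
        rw [inner_groupIntegral hA hi]
        refine integral_congr_ae (Eventually.of_forall fun s => ?_)
        by_cases hs : s ∈ Icc (-(N : ℝ)) N
        · simp [hh, hG, indicator_of_mem hs]
        · simp [hh, indicator_of_notMem hs]
      rw [this, ← ofReal_norm, ← ofReal_norm, ← ofReal_norm, ← ENNReal.ofReal_mul (norm_nonneg _)]
      exact ENNReal.ofReal_le_ofReal (norm_inner_le_norm _ _)
    have h2 := hK.enorm_groupIntegral_sq hK' hA hi hm
    -- By duality the dual estimate is self-improving: `X² ≤ ‖f‖ ‖T h‖` and `‖T h‖² ≤ 2K X²`. The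
    -- common factor `X²` is cancelled below, which needs `X` finite and nonzero.
    have h3 : X ^ 2 * X ^ 2 ≤ 2 * K * ‖f‖ₑ ^ 2 * X ^ 2 :=
      calc X ^ 2 * X ^ 2 = (X ^ 2) ^ 2 := by ring
        _ ≤ (‖f‖ₑ * ‖groupIntegral U A (h N)‖ₑ) ^ 2 := by gcongr
        _ = ‖f‖ₑ ^ 2 * ‖groupIntegral U A (h N)‖ₑ ^ 2 := by ring
        _ ≤ ‖f‖ₑ ^ 2 * (2 * K * X ^ 2) := by gcongr
        _ = _ := by ring
    by_cases hX0 : X = 0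
    · simp [hX0]
    · exact (ENNReal.mul_le_mul_iff_left (by simpa using hX0) (by simpa using hX)).1 h3
  have hlim : eLpNorm G 2 volume ≤ liminf (fun N => eLpNorm (h N) 2 volume) atTop := by
    refine Lp.eLpNorm_lim_le_liminf_eLpNorm
      (fun N => (hGc.aestronglyMeasurable.indicator measurableSet_Icc)) _
      (Eventually.of_forall fun t => ?_)
    refine tendsto_const_nhds.congr' ?_
    filter_upwards [eventually_ge_atTop ⌈|t|⌉₊] with N hN
    exact (indicator_of_mem (show t ∈ Icc (-(N : ℝ)) N from abs_le.1 (Nat.ceil_le.1 hN)) G).symm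
  have hsq : ∀ N, eLpNorm (h N) 2 volume ≤ (2 * K * ‖f‖ₑ ^ 2) ^ (1 / 2 : ℝ) := fun N => by
    rw [one_div, ENNReal.le_rpow_inv_iff (by norm_num)]
    exact_mod_cast hN N
  have hG2 : eLpNorm G 2 volume ≤ (2 * K * ‖f‖ₑ ^ 2) ^ (1 / 2 : ℝ) :=
    hlim.trans ((liminf_le_liminf (Eventually.of_forall hsq)).trans_eq (by simp))
  calc eLpNorm G 2 volume ^ 2 ≤ ((2 * K * ‖f‖ₑ ^ 2) ^ (1 / 2 : ℝ)) ^ 2 := by gcongr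
    _ = _ := by
      rw [← ENNReal.rpow_natCast, ← ENNReal.rpow_mul]
      simp

end

/-! ### The Schrödinger group and its resolvent on the Fourier side. -/

section

variable {n : ℕ}

/-- Multiplication by an essentially bounded function, as an operator on `L²(ℝⁿ)`. -/
def mulOp {m : EuclideanSpace ℝ (Fin n) → ℂ} (hm : MemLp m ∞ volume) : L2 n →L[ℂ] L2 n :=
  (ContinuousLinearMap.lsmul ℂ ℂ).holderL volume ∞ 2 2 (hm.toLp m)

theorem mulOp_eq_smul {m : EuclideanSpace ℝ (Fin n) → ℂ} (hm : MemLp m ∞ volume) (f : L2 n) :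
    mulOp hm f = (hm.toLp m • f : L2 n) := rfl

theorem coeFn_mulOp {m : EuclideanSpace ℝ (Fin n) → ℂ} (hm : MemLp m ∞ volume) (f : L2 n) :
    mulOp hm f =ᵐ[volume] fun x => m x * f x := by
  rw [mulOp_eq_smul]
  filter_upwards [Lp.coeFn_lpSMul (r := 2) (hm.toLp m) f, hm.coeFn_toLp] with x h1 h2
  rw [h1, Pi.smul_apply', h2, smul_eq_mul]

theorem multiplier_eq_mulOp {m : EuclideanSpace ℝ (Fin n) → ℂ} (hm : MemLp m ∞ volume)
    (f : L2 n) : multiplier m hm f =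
      (Lp.fourierTransformₗᵢ (EuclideanSpace ℝ (Fin n)) ℂ).symm
        (mulOp hm (Lp.fourierTransformₗᵢ (EuclideanSpace ℝ (Fin n)) ℂ f)) := rfl

theorem inner_mulOp_right {m : EuclideanSpace ℝ (Fin n) → ℂ} (hm : MemLp m ∞ volume)
    (f g : L2 n) : inner ℂ f (mulOp hm g) = ∫ x, m x * (conj (f x) * g x) := by
  rw [L2.inner_def]
  refine integral_congr_ae ?_
  filter_upwards [coeFn_mulOp hm g] with x hx
  rw [hx, RCLike.inner_apply]
  ring

theorem norm_mulOp_of_norm_eq_one {m : EuclideanSpace ℝ (Fin n) → ℂ} (hm : MemLp m ∞ volume)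
    (h1 : ∀ x, ‖m x‖ = 1) (f : L2 n) : ‖mulOp hm f‖ = ‖f‖ := by
  rw [Lp.norm_def, Lp.norm_def]
  congr 1
  refine eLpNorm_congr_norm_ae ?_
  filter_upwards [coeFn_mulOp hm f] with x hx
  rw [hx, norm_mul, h1, one_mul]

theorem norm_propagatorSymbol (t : ℝ) (ξ : EuclideanSpace ℝ (Fin n)) :
    ‖Complex.exp (-(Complex.I * (t * laplaceSymbol ξ : ℝ)))‖ = 1 := by
  rw [Complex.norm_exp]
  simp

theorem integrable_conj_mul (f g : L2 n) :
    Integrable fun x : EuclideanSpace ℝ (Fin n) => conj (f x) * g x := by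
  have := L2.integrable_inner (𝕜 := ℂ) f g
  refine this.congr (Eventually.of_forall fun x => ?_)
  simp only [RCLike.inner_apply]
  ring

theorem continuous_inner_mulOp_propagatorSymbol (f g : L2 n) :
    Continuous fun t => inner ℂ f (mulOp (memLp_propagatorSymbol n t) g) := by
  simp_rw [inner_mulOp_right]
  refine continuous_of_dominated (bound := fun x => ‖conj (f x) * g x‖) (fun t => ?_) (fun t => ?_)
    (integrable_conj_mul f g).norm (Eventually.of_forall fun x => by fun_prop)
  · exact (memLp_propagatorSymbol n t).1.mul (integrable_conj_mul f g).1
  · refine Eventually.of_forall fun x => ?_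
    rw [norm_mul, norm_propagatorSymbol (n := n), one_mul]

variable (n) in
/-- The free Schrödinger group `e^{itΔ}` on `L²(ℝⁿ)`. -/
def schrodingerGroup : IsometryGroup (L2 n) where
  toFun t :=
    { toFun := propagator t
      map_add' := fun f g => by simp [propagator, multiplier_eq_mulOp]
      map_smul' := fun c f => by simp [propagator, multiplier_eq_mulOp]
      norm_map' := fun f => by
        simp only [LinearMap.coe_mk, AddHom.coe_mk, propagator, multiplier_eq_mulOp,
          LinearIsometryEquiv.norm_map]
        rw [norm_mulOp_of_norm_eq_one _ (norm_propagatorSymbol t), LinearIsometryEquiv.norm_map] }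
  zero_apply f := by
    simp only [LinearIsometry.coe_mk, LinearMap.coe_mk, AddHom.coe_mk, propagator,
      multiplier_eq_mulOp]
    rw [LinearIsometryEquiv.symm_apply_eq]
    refine Lp.ext ?_
    filter_upwards [coeFn_mulOp (memLp_propagatorSymbol n 0)
      (Lp.fourierTransformₗᵢ (EuclideanSpace ℝ (Fin n)) ℂ f)] with x hx
    rw [hx]
    simp
  add_apply s t f := by
    simp only [LinearIsometry.coe_mk, LinearMap.coe_mk, AddHom.coe_mk, propagator,
      multiplier_eq_mulOp, LinearIsometryEquiv.apply_symm_apply]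
    congr 1
    set g := Lp.fourierTransformₗᵢ (EuclideanSpace ℝ (Fin n)) ℂ f
    refine Lp.ext ?_
    filter_upwards [coeFn_mulOp (memLp_propagatorSymbol n (s + t)) g,
      coeFn_mulOp (memLp_propagatorSymbol n s) (mulOp (memLp_propagatorSymbol n t) g),
      coeFn_mulOp (memLp_propagatorSymbol n t) g] with x h1 h2 h3
    rw [h1, h2, h3, ← mul_assoc, ← Complex.exp_add]
    congr 2
    push_cast
    ring
  continuous_apply f := by
    simp only [LinearIsometry.coe_mk, LinearMap.coe_mk, AddHom.coe_mk, propagator,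
      multiplier_eq_mulOp]
    refine (LinearIsometryEquiv.continuous _).comp ?_
    set g := Lp.fourierTransformₗᵢ (EuclideanSpace ℝ (Fin n)) ℂ f
    refine continuous_iff_continuousAt.2 fun s => ?_
    rw [ContinuousAt, tendsto_iff_norm_sub_tendsto_zero]
    set y := mulOp (memLp_propagatorSymbol n s) g with hy
    have hn : ∀ t, ‖mulOp (memLp_propagatorSymbol n t) g‖ = ‖g‖ := fun t =>
      norm_mulOp_of_norm_eq_one _ (norm_propagatorSymbol t) g
    -- Weak continuity together with constancy of the norm gives strong continuity.
    have h1 : ∀ t, ‖mulOp (memLp_propagatorSymbol n t) g - y‖ ^ 2 = 2 * ‖g‖ ^ 2 -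
        2 * (inner ℂ y (mulOp (memLp_propagatorSymbol n t) g)).re := by
      intro t
      rw [@norm_sub_sq ℂ, hn t, hy, hn s, inner_re_symm]
      simp only [RCLike.re_eq_complex_re]
      ring
    have h2 : Tendsto (fun t => ‖mulOp (memLp_propagatorSymbol n t) g - y‖ ^ 2) (𝓝 s) (𝓝 0) := by
      have hc : Continuous fun t => 2 * ‖g‖ ^ 2 -
          2 * (inner ℂ y (mulOp (memLp_propagatorSymbol n t) g)).re :=
        continuous_const.sub (continuous_const.mul
          (Complex.continuous_re.comp (continuous_inner_mulOp_propagatorSymbol y g)))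
      simp_rw [← h1] at hc
      simpa [hy] using hc.tendsto s
    have h3 := h2.sqrt
    simpa [Real.sqrt_sq] using h3

theorem schrodingerGroup_apply (t : ℝ) (f : L2 n) : schrodingerGroup n t f = propagator t f := rfl

/-- The resolvent is the Laplace transform of the group, in both time directions. -/
theorem laplace_eq_freeResolvent (U : IsometryGroup (L2 n)) {σ : ℝ}
    (hU : ∀ r f, U r f = propagator (σ * r) f) {b : ℂ} (hb : 0 < b.re) (z : ℂ) (hz : z.im ≠ 0)
    (c : ℂ) (hc : ∀ l : ℝ, (b + Complex.I * σ * l)⁻¹ = c * ((l : ℂ) - z)⁻¹) (f : L2 n) :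
    laplace U b f = c • freeResolvent z hz f := by
  set P := Lp.fourierTransformₗᵢ (EuclideanSpace ℝ (Fin n)) ℂ with hP
  refine ext_inner_left ℂ fun y => ?_
  rw [inner_laplace U hb]
  have h1 : ∀ (m : EuclideanSpace ℝ (Fin n) → ℂ) (hm : MemLp m ∞ volume),
      inner ℂ y (multiplier m hm f) = ∫ x, m x * (conj (P y x) * P f x) := by
    intro m hm
    rw [multiplier_eq_mulOp, ← hP, ← inner_mulOp_right, ← P.inner_map_map,
      LinearIsometryEquiv.apply_symm_apply]
  simp_rw [inner_smul_right, hU, propagator, freeResolvent, h1,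
    ← integral_const_mul]
  have hprod : Integrable (fun p : ℝ × EuclideanSpace ℝ (Fin n) => Complex.exp (-(b * p.1)) *
      (Complex.exp (-(Complex.I * ((σ * p.1) * laplaceSymbol p.2 : ℝ))) *
        (conj (P y p.2) * P f p.2))) ((volume.restrict (Ioi (0 : ℝ))).prod volume) := by
    refine (Integrable.mul_prod (integrableOn_exp_neg_mul hb) (integrable_conj_mul (P y) (P f))).mono ?_
      (Eventually.of_forall fun p => ?_)
    · have := continuous_laplaceSymbol (n := n)
      refine (Continuous.aestronglyMeasurable (by fun_prop)).mul
        ((Continuous.aestronglyMeasurable (by fun_prop)).mul ?_)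
      exact (integrable_conj_mul (P y) (P f)).1.comp_snd
    · simp only [norm_mul, norm_propagatorSymbol, one_mul, le_refl]
  -- On the Fourier side Fubini leaves `∫_0^∞ e^{-(b + iσl)r} dr = (b + iσl)⁻¹` at `l =
  -- laplaceSymbol x`, which `hc` matches with the resolvent symbol.
  rw [integral_integral_swap hprod]
  refine integral_congr_ae (Eventually.of_forall fun x => ?_)
  simp only
  have h2 : ∀ r : ℝ, Complex.exp (-(b * r)) *
      (Complex.exp (-(Complex.I * ((σ * r) * laplaceSymbol x : ℝ))) * (conj (P y x) * P f x)) =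
      Complex.exp (-(b + Complex.I * σ * laplaceSymbol x) * r) * (conj (P y x) * P f x) := by
    intro r
    rw [← mul_assoc, ← Complex.exp_add]
    congr 2
    push_cast
    ring
  simp_rw [h2]
  rw [integral_mul_const, integral_exp_mul_complex_Ioi (by simpa using hb)]
  rw [← mul_assoc c, ← hc]
  simp only [Complex.ofReal_zero, mul_zero, Complex.exp_zero, neg_div_neg_eq, one_div]

end

/-! ### Bounded truncations of the weight and supersmoothness. -/

section

variable {n : ℕ}

theorem weightedNorm_sq (w : EuclideanSpace ℝ (Fin n) → ℝ≥0∞) (f : EuclideanSpace ℝ (Fin n) → ℂ) :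
    weightedNorm w f ^ 2 = ∫⁻ x, ‖f x‖ₑ ^ 2 * w x := by
  rw [weightedNorm, ← ENNReal.rpow_natCast, ← ENNReal.rpow_mul]
  simp

theorem spaceTimeNorm_sq (w : EuclideanSpace ℝ (Fin n) → ℝ≥0∞)
    (F : ℝ → EuclideanSpace ℝ (Fin n) → ℂ) :
    spaceTimeNorm w F ^ 2 = ∫⁻ t, weightedNorm w (F t) ^ 2 := by
  rw [spaceTimeNorm, ← ENNReal.rpow_natCast, ← ENNReal.rpow_mul]
  simp

theorem enorm_sq_eq_lintegral (f : L2 n) : ‖f‖ₑ ^ 2 = ∫⁻ x, ‖f x‖ₑ ^ 2 := by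
  rw [Lp.enorm_def, eLpNorm_two_sq]

/-- `|V|^{1/2}`, cut off to the set `{|V| ≤ k}`. -/
def cutoffRoot (V : EuclideanSpace ℝ (Fin n) → ℂ) (k : ℕ) (x : EuclideanSpace ℝ (Fin n)) : ℝ :=
  if ‖V x‖ ≤ k then √‖V x‖ else 0

variable {V : EuclideanSpace ℝ (Fin n) → ℂ}

theorem cutoffRoot_nonneg (k : ℕ) (x : EuclideanSpace ℝ (Fin n)) : 0 ≤ cutoffRoot V k x := by
  unfold cutoffRoot
  split_ifs <;> positivity

theorem cutoffRoot_mono {k l : ℕ} (h : k ≤ l) (x : EuclideanSpace ℝ (Fin n)) :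
    cutoffRoot V k x ≤ cutoffRoot V l x := by
  by_cases hx : ‖V x‖ ≤ k
  · rw [cutoffRoot, cutoffRoot, if_pos hx, if_pos (hx.trans (by exact_mod_cast h))]
  · rw [cutoffRoot, if_neg hx]
    exact cutoffRoot_nonneg l x

theorem cutoffRoot_le (k : ℕ) (x : EuclideanSpace ℝ (Fin n)) : cutoffRoot V k x ≤ √‖V x‖ := by
  unfold cutoffRoot
  split_ifs
  · exact le_rfl
  · positivity

theorem eventually_cutoffRoot_eq (x : EuclideanSpace ℝ (Fin n)) :
    ∀ᶠ k : ℕ in atTop, cutoffRoot V k x = √‖V x‖ := by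
  filter_upwards [eventually_ge_atTop ⌈‖V x‖⌉₊] with k hk
  rw [cutoffRoot, if_pos (Nat.ceil_le.1 hk)]

theorem enorm_ofReal_sqrt_sq {a : ℝ} (ha : 0 ≤ a) : ‖((√a : ℝ) : ℂ)‖ₑ ^ 2 = ENNReal.ofReal a := by
  rw [← ofReal_norm, Complex.norm_real, Real.norm_of_nonneg (Real.sqrt_nonneg _),
    ← ENNReal.ofReal_pow (Real.sqrt_nonneg _), Real.sq_sqrt ha]

theorem enorm_root_sq (x : EuclideanSpace ℝ (Fin n)) :
    ‖((√‖V x‖ : ℝ) : ℂ)‖ₑ ^ 2 = absWeight V x := by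
  rw [enorm_ofReal_sqrt_sq (norm_nonneg _), absWeight, ofReal_norm]

theorem enorm_cutoffRoot_le (k : ℕ) (x : EuclideanSpace ℝ (Fin n)) :
    ‖(cutoffRoot V k x : ℂ)‖ₑ ≤ ‖((√‖V x‖ : ℝ) : ℂ)‖ₑ := by
  rw [← ofReal_norm, ← ofReal_norm, Complex.norm_real, Complex.norm_real,
    Real.norm_of_nonneg (cutoffRoot_nonneg _ _), Real.norm_of_nonneg (Real.sqrt_nonneg _)]
  exact ENNReal.ofReal_le_ofReal (cutoffRoot_le k x)

theorem memLp_cutoffRoot (hV : AEMeasurable V volume) (k : ℕ) :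
    MemLp (fun x => (cutoffRoot V k x : ℂ)) ∞ volume := by
  refine memLp_top_of_bound (C := √k) ?_ (Eventually.of_forall fun x => ?_)
  · have h : Measurable fun a : ℝ => ((if a ≤ k then √a else 0 : ℝ) : ℂ) :=
      Complex.measurable_ofReal.comp
        (Measurable.ite measurableSet_Iic Real.continuous_sqrt.measurable measurable_const)
    exact (h.comp_aemeasurable hV.norm).aestronglyMeasurable
  · rw [Complex.norm_real, Real.norm_of_nonneg (cutoffRoot_nonneg _ _), cutoffRoot]
    split_ifs with h
    · exact Real.sqrt_le_sqrt h
    · positivity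

/-- Multiplication by `|V|^{1/2}`, cut off to the set `{|V| ≤ k}`. -/
def cutoffOp (hV : AEMeasurable V volume) (k : ℕ) : L2 n →L[ℂ] L2 n :=
  mulOp (memLp_cutoffRoot hV k)

theorem coeFn_cutoffOp (hV : AEMeasurable V volume) (k : ℕ) (f : L2 n) :
    cutoffOp hV k f =ᵐ[volume] fun x => (cutoffRoot V k x : ℂ) * f x :=
  coeFn_mulOp _ _

theorem inner_cutoffOp (hV : AEMeasurable V volume) (k : ℕ) (f g : L2 n) :
    inner ℂ (cutoffOp hV k f) g = inner ℂ f (cutoffOp hV k g) := by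
  rw [L2.inner_def, L2.inner_def]
  refine integral_congr_ae ?_
  filter_upwards [coeFn_cutoffOp hV k f, coeFn_cutoffOp hV k g] with x h1 h2
  rw [h1, h2, RCLike.inner_apply, RCLike.inner_apply, map_mul, Complex.conj_ofReal]
  ring

theorem enorm_cutoffOp_sq (hV : AEMeasurable V volume) (k : ℕ) (f : L2 n) :
    ‖cutoffOp hV k f‖ₑ ^ 2 = ∫⁻ x, ‖(cutoffRoot V k x : ℂ)‖ₑ ^ 2 * ‖f x‖ₑ ^ 2 := by
  rw [enorm_sq_eq_lintegral]
  refine lintegral_congr_ae ?_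
  filter_upwards [coeFn_cutoffOp hV k f] with x hx
  rw [hx, enorm_mul, mul_pow]

theorem enorm_cutoffOp_le_weightedNorm (hV : AEMeasurable V volume) (k : ℕ) (f : L2 n) :
    ‖cutoffOp hV k f‖ₑ ≤ weightedNorm (absWeight V) f := by
  rw [← ENNReal.pow_le_pow_left_iff two_ne_zero, enorm_cutoffOp_sq, weightedNorm_sq]
  refine lintegral_mono fun x => ?_
  rw [← enorm_root_sq, mul_comm]
  gcongr
  exact enorm_cutoffRoot_le k x

theorem enorm_cutoffOp_mono (hV : AEMeasurable V volume) {k l : ℕ} (h : k ≤ l) (f : L2 n) :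
    ‖cutoffOp hV k f‖ₑ ≤ ‖cutoffOp hV l f‖ₑ := by
  rw [← ENNReal.pow_le_pow_left_iff two_ne_zero, enorm_cutoffOp_sq, enorm_cutoffOp_sq]
  refine lintegral_mono fun x => ?_
  gcongr
  rw [← ofReal_norm, ← ofReal_norm, Complex.norm_real, Complex.norm_real,
    Real.norm_of_nonneg (cutoffRoot_nonneg _ _), Real.norm_of_nonneg (cutoffRoot_nonneg _ _)]
  exact ENNReal.ofReal_le_ofReal (cutoffRoot_mono h x)

/-- Monotone convergence. This is how bounds uniform in the truncation pass to the full weight. -/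
theorem weightedNorm_sq_eq_iSup (hV : AEMeasurable V volume) (f : L2 n) :
    weightedNorm (absWeight V) f ^ 2 = ⨆ k, ‖cutoffOp hV k f‖ₑ ^ 2 := by
  simp_rw [weightedNorm_sq, enorm_cutoffOp_sq]
  have hm : ∀ k, AEMeasurable fun x => ‖(cutoffRoot V k x : ℂ)‖ₑ ^ 2 * ‖f x‖ₑ ^ 2 := fun k =>
    ((memLp_cutoffRoot hV k).1.enorm.pow_const 2).mul
      ((Lp.aestronglyMeasurable f).enorm.pow_const 2)
  have hmono : ∀ x, Monotone fun k => ‖(cutoffRoot V k x : ℂ)‖ₑ ^ 2 * ‖f x‖ₑ ^ 2 := fun x =>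
    monotone_nat_of_le_succ fun k => by
      gcongr
      rw [← ofReal_norm, ← ofReal_norm, Complex.norm_real, Complex.norm_real,
        Real.norm_of_nonneg (cutoffRoot_nonneg _ _), Real.norm_of_nonneg (cutoffRoot_nonneg _ _)]
      exact ENNReal.ofReal_le_ofReal (cutoffRoot_mono k.le_succ x)
  rw [← lintegral_iSup' hm (Eventually.of_forall hmono)]
  refine lintegral_congr fun x => ?_
  refine le_antisymm ?_ (iSup_le fun k => ?_)
  · obtain ⟨k, hk⟩ := (eventually_cutoffRoot_eq (V := V) x).exists
    refine le_iSup_of_le k ?_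
    rw [hk, enorm_root_sq, mul_comm]
  · rw [← enorm_root_sq, mul_comm]
    gcongr
    exact enorm_cutoffRoot_le k x

/-- The square of the truncated root is at most `|V|`, which cancels the weight. Where `V = 0` the
truncated root vanishes and `0 · ∞ = 0`. -/
theorem weightedNorm_cutoffOp_le (hV : AEMeasurable V volume) (k : ℕ) (f : L2 n) :
    weightedNorm (invWeight V) (cutoffOp hV k f) ≤ ‖f‖ₑ := by
  rw [← ENNReal.pow_le_pow_left_iff two_ne_zero, weightedNorm_sq, enorm_sq_eq_lintegral]
  refine lintegral_mono_ae ?_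
  filter_upwards [coeFn_cutoffOp hV k f] with x hx
  rw [hx, enorm_mul, mul_pow]
  by_cases h0 : V x = 0
  · have : cutoffRoot V k x = 0 := by simp [cutoffRoot, h0]
    simp [this]
  · have h1 : ‖(cutoffRoot V k x : ℂ)‖ₑ ^ 2 ≤ ‖V x‖ₑ := by
      calc _ ≤ ‖((√‖V x‖ : ℝ) : ℂ)‖ₑ ^ 2 := by gcongr; exact enorm_cutoffRoot_le k x
        _ = _ := enorm_root_sq x
    calc ‖(cutoffRoot V k x : ℂ)‖ₑ ^ 2 * ‖f x‖ₑ ^ 2 * invWeight V x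
        ≤ ‖V x‖ₑ * ‖f x‖ₑ ^ 2 * ‖V x‖ₑ⁻¹ := by
          rw [invWeight]
          gcongr
      _ = ‖f x‖ₑ ^ 2 * (‖V x‖ₑ * ‖V x‖ₑ⁻¹) := by ring
      _ = ‖f x‖ₑ ^ 2 := by
          rw [ENNReal.mul_inv_cancel (by simpa using h0) enorm_ne_top, mul_one]

theorem UniformResolventEstimate.norm_cutoffOp_le {K : ℝ≥0} (hK : UniformResolventEstimate V K)
    (hV : AEMeasurable V volume) (k : ℕ) (z : ℂ) (hz : z.im ≠ 0) (f : L2 n) :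
    ‖cutoffOp hV k (freeResolvent z hz (cutoffOp hV k f))‖ ≤ K * ‖f‖ := by
  have h : ‖cutoffOp hV k (freeResolvent z hz (cutoffOp hV k f))‖ₑ ≤ K * ‖f‖ₑ :=
    (enorm_cutoffOp_le_weightedNorm hV k _).trans <|
      (hK z hz _ ((weightedNorm_cutoffOp_le hV k f).trans_lt enorm_lt_top)).trans
        (mul_le_mul_right (weightedNorm_cutoffOp_le hV k f) _)
  rw [enorm_eq_nnnorm, enorm_eq_nnnorm] at h
  exact_mod_cast h

/-- With `b = ε + 2πiτ` one has `b + il = i(l - z)` for `z = -2πτ + iε`, so the Laplace transform is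
`-i R₀(z)` in the upper half plane. -/
theorem UniformResolventEstimate.supersmooth {K : ℝ≥0} (hK : UniformResolventEstimate V K)
    (hV : AEMeasurable V volume) (k : ℕ) :
    Supersmooth (schrodingerGroup n) (cutoffOp hV k) K := by
  intro ε hε τ x
  have hz : (((-2 * Real.pi * τ : ℝ) : ℂ) + ε * Complex.I).im ≠ 0 := by simpa using hε.ne'
  rw [laplace_eq_freeResolvent (σ := 1) _ (fun r f => by rw [one_mul, schrodingerGroup_apply])
    (by simpa using hε) _ hz (-Complex.I) (fun l => ?_), map_smul, norm_smul, norm_neg,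
    Complex.norm_I, one_mul]
  · exact hK.norm_cutoffOp_le hV k _ hz x
  · rw [← Complex.inv_I, ← mul_inv]
    congr 1
    push_cast
    linear_combination (ε : ℂ) * Complex.I_sq

/-- Here `b - il = -i(l - z)` for `z = 2πτ - iε`, so the lower half plane is used. -/
theorem UniformResolventEstimate.supersmooth_reverse {K : ℝ≥0}
    (hK : UniformResolventEstimate V K) (hV : AEMeasurable V volume) (k : ℕ) :
    Supersmooth (schrodingerGroup n).reverse (cutoffOp hV k) K := by
  intro ε hε τ x
  have hz : (((2 * Real.pi * τ : ℝ) : ℂ) - ε * Complex.I).im ≠ 0 := by simpa using hε.ne'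
  rw [laplace_eq_freeResolvent (σ := -1) _ (fun r f => by
      rw [neg_one_mul, IsometryGroup.reverse_apply, schrodingerGroup_apply])
    (by simpa using hε) _ hz Complex.I (fun l => ?_), map_smul, norm_smul, Complex.norm_I, one_mul]
  · exact hK.norm_cutoffOp_le hV k _ hz x
  · rw [show ∀ w : ℂ, Complex.I * w⁻¹ = (-Complex.I * w)⁻¹ from fun w => by
      rw [mul_inv, inv_neg, Complex.inv_I, neg_neg]]
    congr 1
    push_cast
    linear_combination (ε : ℂ) * Complex.I_sq

end

/-! ### Weak limits and weak measurability in Hilbert space. -/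

section

section Hilbert

variable {H : Type*} [NormedAddCommGroup H] [InnerProductSpace ℂ H]

theorem enorm_inner_le (x y : H) : ‖inner ℂ x y‖ₑ ≤ ‖x‖ₑ * ‖y‖ₑ := by
  rw [← ofReal_norm, ← ofReal_norm, ← ofReal_norm, ← ENNReal.ofReal_mul (norm_nonneg _)]
  exact ENNReal.ofReal_le_ofReal (norm_inner_le_norm _ _)

/-- Orthonormal vectors lie `√2` apart, so balls of radius `1/2` around them are disjoint open sets.
-/
theorem countable_of_orthonormal [TopologicalSpace.SeparableSpace H] {w : Set H}
    (hw : Orthonormal ℂ ((↑) : w → H)) : w.Countable := by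
  have hd : ∀ x ∈ w, ∀ y ∈ w, x ≠ y → 1 ≤ dist x y := by
    intro x hx y hy hxy
    have h0 : inner ℂ x y = 0 := hw.2 (i := ⟨x, hx⟩) (j := ⟨y, hy⟩) (by simpa using hxy)
    have h2 : ‖x - y‖ ^ 2 = 2 := by
      rw [@norm_sub_sq ℂ, h0, hw.1 ⟨x, hx⟩, hw.1 ⟨y, hy⟩]
      norm_num
    rw [dist_eq_norm]
    nlinarith [norm_nonneg (x - y)]
  refine Set.PairwiseDisjoint.countable_of_isOpen (s := fun x => Metric.ball x (1 / 2))
    (fun x hx y hy hxy => ?_) (fun x _ => Metric.isOpen_ball)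
    (fun x _ => ⟨x, Metric.mem_ball_self (by norm_num)⟩)
  exact Metric.ball_disjoint_ball (by norm_num; exact hd x hx y hy hxy)

/-- Weak measurability implies strong measurability in a separable Hilbert space. -/
theorem aestronglyMeasurable_of_inner [CompleteSpace H] [TopologicalSpace.SeparableSpace H]
    {α : Type*} [MeasurableSpace α] {μ : Measure α} {g : α → H}
    (hg : ∀ y, AEStronglyMeasurable (fun a => inner ℂ y (g a)) μ) : AEStronglyMeasurable g μ := by
  obtain ⟨w, b, hb⟩ := exists_hilbertBasis ℂ H
  have : Countable w := (countable_of_orthonormal (hb ▸ b.orthonormal)).to_subtype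
  refine aestronglyMeasurable_of_tendsto_ae (atTop : Filter (Finset w))
    (f := fun s a => ∑ i ∈ s, b.repr (g a) i • b i) (fun s => ?_)
    (Eventually.of_forall fun a => b.hasSum_repr (g a))
  refine Finset.aestronglyMeasurable_fun_sum s fun i _ => ?_
  simp_rw [b.repr_apply_apply]
  exact (hg _).smul_const _

/-- A bounded weakly Cauchy sequence has a weak limit. -/
theorem exists_weak_limit [CompleteSpace H] {x : ℕ → H} {C : ℝ} (hx : ∀ k, ‖x k‖ ≤ C) {L : H → ℂ}
    (hL : ∀ f, Tendsto (fun k => inner ℂ f (x k)) atTop (𝓝 (L f))) :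
    ∃ u : H, ‖u‖ ≤ C ∧ ∀ f, inner ℂ f u = L f := by
  have hC : 0 ≤ C := (norm_nonneg _).trans (hx 0)
  -- The limit `L` is conjugate linear because the inner product is so in its first slot;
  -- conjugating it gives a linear functional for the Riesz theorem.
  let ℓ : H →ₗ[ℂ] ℂ :=
    { toFun := fun f => conj (L f)
      map_add' := fun f g => by
        rw [← map_add]
        congr 1
        refine tendsto_nhds_unique (hL (f + g)) ?_
        simp_rw [inner_add_left]
        exact (hL f).add (hL g)
      map_smul' := fun c f => by
        rw [RingHom.id_apply, smul_eq_mul, ← Complex.conj_conj c, ← map_mul, Complex.conj_conj]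
        congr 1
        refine tendsto_nhds_unique (hL (c • f)) ?_
        simp_rw [inner_smul_left]
        exact (hL f).const_mul _ }
  have hℓ : ∀ f, ‖ℓ f‖ ≤ C * ‖f‖ := by
    intro f
    change ‖conj (L f)‖ ≤ C * ‖f‖
    rw [RCLike.norm_conj]
    refine le_of_tendsto (hL f).norm (Eventually.of_forall fun k => ?_)
    calc ‖inner ℂ f (x k)‖ ≤ ‖f‖ * ‖x k‖ := norm_inner_le_norm _ _
      _ ≤ ‖f‖ * C := by gcongr; exact hx k
      _ = C * ‖f‖ := mul_comm _ _
  refine ⟨(InnerProductSpace.toDual ℂ H).symm (ℓ.mkContinuous C hℓ), ?_, fun f => ?_⟩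
  · rw [LinearIsometryEquiv.norm_map]
    exact ℓ.mkContinuous_norm_le hC hℓ
  · rw [← inner_conj_symm, InnerProductSpace.toDual_symm_apply]
    exact Complex.conj_conj _

/-- The norm is weakly lower semicontinuous. -/
theorem enorm_sq_le_liminf {x : ℕ → H} {y : H}
    (h : Tendsto (fun k => inner ℂ y (x k)) atTop (𝓝 (inner ℂ y y))) :
    ‖y‖ₑ ^ 2 ≤ liminf (fun k => ‖x k‖ₑ ^ 2) atTop := by
  by_cases hy : ‖y‖ₑ = 0
  · simp [hy]
  -- Cauchy–Schwarz for `⟨y, x k⟩` in the limit; dividing by `‖y‖²` gives the claim.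
  have h1 : (‖y‖ₑ ^ 2) * ‖y‖ₑ ^ 2 ≤ ‖y‖ₑ ^ 2 * liminf (fun k => ‖x k‖ₑ ^ 2) atTop := by
    have h2 := ((ENNReal.continuous_pow 2).tendsto _).comp h.enorm
    have h3 : ‖inner ℂ y y‖ₑ = ‖y‖ₑ ^ 2 := by
      rw [inner_self_eq_norm_sq_to_K, enorm_pow, ← ofReal_norm, ← ofReal_norm]
      simp
    rw [← sq, ← h3, ← ENNReal.liminf_const_mul_of_ne_top (by finiteness), ← h2.liminf_eq, h3]
    refine liminf_le_liminf (Eventually.of_forall fun k => ?_)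
    simp only [Function.comp_apply]
    rw [← mul_pow]
    gcongr
    exact enorm_inner_le _ _
  exact (ENNReal.mul_le_mul_iff_right (by simpa using hy) (by finiteness)).1 h1

variable {U : IsometryGroup H} {A : H →L[ℂ] H}

theorem integrable_group_sub (U : IsometryGroup H) (A : H →L[ℂ] H) {h : ℝ → H}
    (hh : Integrable h) (t : ℝ) : Integrable fun s => U (t - s) (A (h s)) :=
  (A.integrable_comp hh).mono (aestronglyMeasurable_group_apply U
    (Continuous.aestronglyMeasurable (by fun_prop)) (A.integrable_comp hh).aestronglyMeasurable)
    (Eventually.of_forall fun s => by simp)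

/-- Factoring out `U t` leaves the primitive of an integrable function, and the joint continuity of
the group applies. -/
theorem continuous_duhamel [CompleteSpace H] (U : IsometryGroup H) (A : H →L[ℂ] H) {h : ℝ → H}
    (hh : Integrable h) : Continuous (duhamel U A h) := by
  have h1 : ∀ t, duhamel U A h t = U t (∫ s in (0 : ℝ)..t, U (0 - s) (A (h s))) := by
    intro t
    rw [duhamel]
    have := (U t).toContinuousLinearMap.intervalIntegral_comp_comm (a := 0) (b := t)
      ((integrable_group_sub U A hh 0).intervalIntegrable)
    simp only [LinearIsometry.coe_toContinuousLinearMap] at this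
    rw [← this]
    simp_rw [← U.add_apply, zero_sub, sub_eq_add_neg]
  have h2 : duhamel U A h = fun t => Function.uncurry (fun t x => U t x)
      (t, ∫ s in (0 : ℝ)..t, U (0 - s) (A (h s))) := funext h1
  rw [h2]
  exact U.continuous_uncurry.comp (continuous_id.prodMk (intervalIntegral.continuous_primitive
    (fun a b => (integrable_group_sub U A hh 0).intervalIntegrable) 0))

theorem inner_duhamel [CompleteSpace H] (U : IsometryGroup H) (A : H →L[ℂ] H) {h : ℝ → H}
    (hh : Integrable h) (f : H) (t : ℝ) :
    inner ℂ f (duhamel U A h t) =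
      ∫ s in (0 : ℝ)..t, inner ℂ (U s (U (-t) f)) (A (h s)) := by
  have h1 := (innerSL ℂ f).intervalIntegral_comp_comm (a := 0) (b := t)
    ((integrable_group_sub U A hh t).intervalIntegrable)
  simp only [innerSL_apply_apply] at h1
  rw [duhamel, ← h1]
  refine intervalIntegral.integral_congr fun s _ => ?_
  rw [← U.add_apply, U.inner_apply_left, neg_add, neg_neg, add_comm, sub_eq_add_neg]

end Hilbert

end

/-! ### Removal of the truncation: homogeneous and dual estimates. -/

section

variable {n : ℕ} {V : EuclideanSpace ℝ (Fin n) → ℂ} {K : ℝ≥0}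

theorem continuous_propagator (f : L2 n) : Continuous fun t => propagator t f :=
  (schrodingerGroup n).continuous_apply f

theorem propagator_propagator (s t : ℝ) (f : L2 n) :
    propagator s (propagator t f) = propagator (s + t) f :=
  ((schrodingerGroup n).add_apply s t f).symm

theorem measurable_weightedNorm (hV : AEMeasurable V volume) {g : ℝ → L2 n} (hg : Continuous g) :
    Measurable fun t => weightedNorm (absWeight V) (g t) := by
  have h1 : Measurable fun t => weightedNorm (absWeight V) (g t) ^ 2 := by
    simp_rw [weightedNorm_sq_eq_iSup hV]
    exact Measurable.iSup fun k =>
      (((cutoffOp hV k).continuous.comp hg).enorm.measurable).pow_const 2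
  have h2 : ∀ t, weightedNorm (absWeight V) (g t) =
      (weightedNorm (absWeight V) (g t) ^ 2) ^ (1 / 2 : ℝ) := by
    intro t
    rw [← ENNReal.rpow_natCast, ← ENNReal.rpow_mul]
    simp
  rw [funext h2]
  exact h1.pow_const _

/-- The homogeneous smoothing estimate. -/
theorem UniformResolventEstimate.spaceTimeNorm_propagator_sq (hK : UniformResolventEstimate V K)
    (hV : AEMeasurable V volume) (f : L2 n) :
    spaceTimeNorm (absWeight V) (fun t => propagator t f) ^ 2 ≤ 2 * K * ‖f‖ₑ ^ 2 := by
  rw [spaceTimeNorm_sq]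
  simp_rw [weightedNorm_sq_eq_iSup hV]
  rw [lintegral_iSup (f := fun k t => ‖cutoffOp hV k (propagator t f)‖ₑ ^ 2)
    (fun k => ((((cutoffOp hV k).continuous.comp
      (continuous_propagator f)).enorm.measurable).pow_const 2)) (fun k l hkl t => by
      have := enorm_cutoffOp_mono hV hkl (propagator t f)
      simp only
      gcongr)]
  refine iSup_le fun k => ?_
  have := (hK.supersmooth hV k).eLpNorm_apply_group_sq (hK.supersmooth_reverse hV k)
    (inner_cutoffOp hV k) f
  rwa [eLpNorm_two_sq] at this

section Slice

theorem sq_lt_top_iff {a : ℝ≥0∞} : a ^ 2 < ∞ ↔ a < ∞ := by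
  simp

theorem memLp_root_mul (hV : AEMeasurable V volume) {v : L2 n}
    (hv : weightedNorm (absWeight V) v < ∞) : MemLp (fun x => ((√‖V x‖ : ℝ) : ℂ) * v x) 2 := by
  refine ⟨?_, ?_⟩
  · exact (Complex.measurable_ofReal.comp_aemeasurable
      (Real.continuous_sqrt.measurable.comp_aemeasurable hV.norm)).aestronglyMeasurable.mul
        (Lp.aestronglyMeasurable v)
  · rw [← sq_lt_top_iff, eLpNorm_two_sq]
    rw [← sq_lt_top_iff, weightedNorm_sq] at hv
    refine lt_of_eq_of_lt (lintegral_congr fun x => ?_) hv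
    rw [enorm_mul, mul_pow, enorm_root_sq, mul_comm]

/-- Although `|V|^{1/2} u` may fail to be in `L²`, its pairing with `v` converges because the root
can be moved onto `v`. -/
theorem integrable_root_mul_conj (hV : AEMeasurable V volume) (u : L2 n) {v : L2 n}
    (hv : weightedNorm (absWeight V) v < ∞) :
    Integrable fun x => ((√‖V x‖ : ℝ) : ℂ) * u x * conj (v x) := by
  have h := (Lp.memLp u).integrable_mul (memLp_root_mul hV hv).star
  refine h.congr (Eventually.of_forall fun x => ?_)
  simp only [Pi.mul_apply, Pi.star_apply, star_mul', RCLike.star_def, Complex.conj_ofReal]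
  ring

theorem tendsto_inner_cutoffOp (hV : AEMeasurable V volume) (u : L2 n) {v : L2 n}
    (hv : weightedNorm (absWeight V) v < ∞) :
    Tendsto (fun k => inner ℂ v (cutoffOp hV k u)) atTop
      (𝓝 (∫ x, ((√‖V x‖ : ℝ) : ℂ) * u x * conj (v x))) := by
  have h1 : ∀ k, inner ℂ v (cutoffOp hV k u) =
      ∫ x, (cutoffRoot V k x : ℂ) * (conj (v x) * u x) := fun k => inner_mulOp_right _ v u
  simp_rw [h1]
  refine tendsto_integral_of_dominated_convergence
    (fun x => ‖((√‖V x‖ : ℝ) : ℂ) * u x * conj (v x)‖)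
    (fun k => (memLp_cutoffRoot hV k).1.mul (integrable_conj_mul v u).1)
    (integrable_root_mul_conj hV u hv).norm (fun k => Eventually.of_forall fun x => ?_)
    (Eventually.of_forall fun x => ?_)
  · rw [mul_assoc, norm_mul, norm_mul ((√‖V x‖ : ℝ) : ℂ), mul_comm (u x), Complex.norm_real,
      Complex.norm_real, Real.norm_of_nonneg (cutoffRoot_nonneg _ _),
      Real.norm_of_nonneg (Real.sqrt_nonneg _)]
    gcongr
    exact cutoffRoot_le k x
  · refine tendsto_const_nhds.congr' ?_
    filter_upwards [eventually_cutoffRoot_eq (V := V) x] with k hk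
    rw [hk]
    ring

theorem enorm_inner_cutoffOp_le (hV : AEMeasurable V volume) (k : ℕ) (u v : L2 n) :
    ‖inner ℂ v (cutoffOp hV k u)‖ₑ ≤ ‖u‖ₑ * weightedNorm (absWeight V) v := by
  rw [← inner_cutoffOp, mul_comm]
  exact (enorm_inner_le _ _).trans
    (mul_le_mul_left (enorm_cutoffOp_le_weightedNorm hV k v) _)

end Slice

section SpaceTime

theorem UniformResolventEstimate.ae_weightedNorm_lt_top (hK : UniformResolventEstimate V K)
    (hV : AEMeasurable V volume) (f : L2 n) :
    ∀ᵐ s : ℝ, weightedNorm (absWeight V) (propagator s f) < ∞ := by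
  have h : ∫⁻ s, weightedNorm (absWeight V) (propagator s f) ^ 2 ≠ ∞ := by
    rw [← spaceTimeNorm_sq]
    exact ((hK.spaceTimeNorm_propagator_sq hV f).trans_lt (by finiteness)).ne
  filter_upwards [ae_lt_top ((measurable_weightedNorm hV (continuous_propagator f)).pow_const 2) h]
    with s hs
  exact by simpa using hs

/-- A function dominating all the pairings of the cut-off forcing terms with an orbit. -/
theorem UniformResolventEstimate.exists_integrable_bound (hK : UniformResolventEstimate V K)
    (hV : AEMeasurable V volume) {g : ℝ → L2 n} (hg : MemLp g 2) (f : L2 n) :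
    ∃ b : ℝ → ℝ, Integrable b ∧ ∀ᵐ s : ℝ, ∀ k,
      ‖inner ℂ (propagator s f) (cutoffOp hV k (g s))‖ ≤ b s := by
  have hwm := measurable_weightedNorm hV (continuous_propagator f)
  have hm : AEMeasurable fun s => ‖g s‖ₑ * weightedNorm (absWeight V) (propagator s f) :=
    hg.1.enorm.mul hwm.aemeasurable
  -- Cauchy–Schwarz in time: `g` is square integrable, and the second factor is so by the
  -- homogeneous estimate.
  have hfin : ∫⁻ s, ‖g s‖ₑ * weightedNorm (absWeight V) (propagator s f) ≠ ∞ := by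
    refine ((ENNReal.lintegral_mul_le_Lp_mul_Lq volume Real.HolderConjugate.two_two hg.1.enorm
      hwm.aemeasurable).trans_lt (ENNReal.mul_lt_top ?_ ?_)).ne
    · refine ENNReal.rpow_lt_top_of_nonneg (by norm_num) ?_
      have h : eLpNorm g 2 volume ^ 2 ≠ ∞ := by
        have := hg.2
        finiteness
      rw [eLpNorm_two_sq] at h
      exact_mod_cast h
    · refine ENNReal.rpow_lt_top_of_nonneg (by norm_num) ?_
      have h : spaceTimeNorm (absWeight V) (fun t => propagator t f) ^ 2 ≠ ∞ :=
        ((hK.spaceTimeNorm_propagator_sq hV f).trans_lt (by finiteness)).ne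
      rw [spaceTimeNorm_sq] at h
      exact_mod_cast h
  refine ⟨_, integrable_toReal_of_lintegral_ne_top hm hfin, ?_⟩
  filter_upwards [ae_lt_top' hm hfin] with s hs k
  rw [← toReal_enorm]
  exact ENNReal.toReal_mono hs.ne (enorm_inner_cutoffOp_le hV k _ _)

/-- The part of a forcing term in `[-k, k]`. -/
def timeCutoff (k : ℕ) (g : ℝ → L2 n) : ℝ → L2 n := (Icc (-(k : ℝ)) k).indicator g

theorem memLp_timeCutoff (k : ℕ) {g : ℝ → L2 n} (hg : MemLp g 2) : MemLp (timeCutoff k g) 2 :=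
  hg.indicator measurableSet_Icc

theorem integrable_timeCutoff (k : ℕ) {g : ℝ → L2 n} (hg : MemLp g 2) :
    Integrable (timeCutoff k g) :=
  (integrable_indicator_iff measurableSet_Icc).2
    ((hg.restrict (Icc (-(k : ℝ)) k)).integrable one_le_two)

theorem eLpNorm_timeCutoff_le (k : ℕ) (g : ℝ → L2 n) :
    eLpNorm (timeCutoff k g) 2 volume ≤ eLpNorm g 2 volume := eLpNorm_indicator_le g

theorem eventually_timeCutoff_eq (g : ℝ → L2 n) (t : ℝ) :
    ∀ᶠ k : ℕ in atTop, timeCutoff k g t = g t := by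
  filter_upwards [eventually_ge_atTop ⌈|t|⌉₊] with k hk
  exact indicator_of_mem (show t ∈ Icc (-(k : ℝ)) k from abs_le.1 (Nat.ceil_le.1 hk)) g

/-- The pairing of the forcing term `|V|^{1/2} g` with an orbit of the free group. -/
def rootPairing (V : EuclideanSpace ℝ (Fin n) → ℂ) (g : ℝ → L2 n) (f : L2 n) (s : ℝ) : ℂ :=
  ∫ x, ((√‖V x‖ : ℝ) : ℂ) * g s x * conj (propagator s f x)

theorem aestronglyMeasurable_inner_cutoffOp (hV : AEMeasurable V volume) {g : ℝ → L2 n}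
    (hg : AEStronglyMeasurable g) (f : L2 n) (k : ℕ) :
    AEStronglyMeasurable fun s => inner ℂ (propagator s f) (cutoffOp hV k (g s)) :=
  (continuous_propagator f).aestronglyMeasurable.inner
    ((cutoffOp hV k).continuous.comp_aestronglyMeasurable hg)

theorem UniformResolventEstimate.integrable_rootPairing (hK : UniformResolventEstimate V K)
    (hV : AEMeasurable V volume) {g : ℝ → L2 n} (hg : MemLp g 2) (f : L2 n) :
    Integrable (rootPairing V g f) := by
  obtain ⟨b, hb, hle⟩ := hK.exists_integrable_bound hV hg f
  have hlim : ∀ᵐ s : ℝ, Tendsto (fun k => inner ℂ (propagator s f) (cutoffOp hV k (g s))) atTop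
      (𝓝 (rootPairing V g f s)) := by
    filter_upwards [hK.ae_weightedNorm_lt_top hV f] with s hs
    exact tendsto_inner_cutoffOp hV _ hs
  refine hb.mono' (aestronglyMeasurable_of_tendsto_ae atTop
    (aestronglyMeasurable_inner_cutoffOp hV hg.1 f) hlim) ?_
  filter_upwards [hle, hlim] with s h1 h2
  exact le_of_tendsto h2.norm (Eventually.of_forall h1)

/-- The truncations of the weight and of time are removed together by dominated convergence. A
general `I` covers both the whole line and the Duhamel interval. -/
theorem UniformResolventEstimate.tendsto_setIntegral (hK : UniformResolventEstimate V K)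
    (hV : AEMeasurable V volume) {g : ℝ → L2 n} (hg : MemLp g 2) (f : L2 n) (I : Set ℝ) :
    Tendsto (fun k => ∫ s in I, inner ℂ (propagator s f) (cutoffOp hV k (timeCutoff k g s))) atTop
      (𝓝 (∫ s in I, rootPairing V g f s)) := by
  obtain ⟨b, hb, hle⟩ := hK.exists_integrable_bound hV hg f
  refine tendsto_integral_of_dominated_convergence b
    (fun k => (aestronglyMeasurable_inner_cutoffOp hV (memLp_timeCutoff k hg).1 f k).restrict)
    hb.integrableOn (fun k => ae_restrict_of_ae ?_) (ae_restrict_of_ae ?_)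
  · filter_upwards [hle] with s hs
    by_cases h : s ∈ Icc (-(k : ℝ)) k
    · rw [timeCutoff, indicator_of_mem h]
      exact hs k
    · rw [timeCutoff, indicator_of_notMem h, map_zero, inner_zero_right, norm_zero]
      exact (norm_nonneg _).trans (hs 0)
  · filter_upwards [hK.ae_weightedNorm_lt_top hV f] with s hs
    refine (tendsto_inner_cutoffOp hV (g s) hs).congr' ?_
    filter_upwards [eventually_timeCutoff_eq g s] with k hk
    rw [hk]

/-- The dual smoothing estimate. -/
theorem UniformResolventEstimate.exists_integral (hK : UniformResolventEstimate V K)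
    (hV : AEMeasurable V volume) {g : ℝ → L2 n} (hg : MemLp g 2) :
    ∃ u : L2 n, ‖u‖ₑ ^ 2 ≤ 2 * K * eLpNorm g 2 volume ^ 2 ∧
      ∀ f, inner ℂ f u = ∫ s, rootPairing V g f s := by
  set T : ℕ → L2 n := fun k =>
    groupIntegral (schrodingerGroup n) (cutoffOp hV k) (timeCutoff k g) with hT
  set B : ℝ≥0∞ := (2 * K * eLpNorm g 2 volume ^ 2) ^ (1 / 2 : ℝ) with hB
  have hB2 : B ^ 2 = 2 * K * eLpNorm g 2 volume ^ 2 := by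
    rw [hB, ← ENNReal.rpow_natCast, ← ENNReal.rpow_mul]
    simp
  have hBtop : B ≠ ∞ := by
    rw [← lt_top_iff_ne_top, ← sq_lt_top_iff, hB2]
    have := hg.2
    finiteness
  have hTB : ∀ k, ‖T k‖ₑ ≤ B := by
    intro k
    rw [← ENNReal.pow_le_pow_left_iff two_ne_zero, hB2]
    refine ((hK.supersmooth hV k).enorm_groupIntegral_sq (hK.supersmooth_reverse hV k)
      (inner_cutoffOp hV k) (integrable_timeCutoff k hg) (memLp_timeCutoff k hg)).trans ?_
    gcongr
    exact eLpNorm_timeCutoff_le k g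
  have hlim : ∀ f, Tendsto (fun k => inner ℂ f (T k)) atTop
      (𝓝 (∫ s, rootPairing V g f s)) := by
    intro f
    have h := hK.tendsto_setIntegral hV hg f univ
    simp only [Measure.restrict_univ] at h
    refine h.congr fun k => ?_
    rw [hT, inner_groupIntegral (inner_cutoffOp hV k) (integrable_timeCutoff k hg)]
    refine integral_congr_ae (Eventually.of_forall fun s => ?_)
    simp only [inner_cutoffOp, schrodingerGroup_apply]
  obtain ⟨u, hu, hu'⟩ := exists_weak_limit (C := B.toReal) (fun k => by
    rw [← toReal_enorm]
    exact ENNReal.toReal_mono hBtop (hTB k)) hlim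
  refine ⟨u, ?_, hu'⟩
  rw [← hB2]
  gcongr
  rw [← ofReal_norm]
  exact ENNReal.ofReal_le_of_le_toReal hu

end SpaceTime

end

/-! ### Forcing terms in the weighted space and the retarded estimate. -/

section

variable {n : ℕ} {V : EuclideanSpace ℝ (Fin n) → ℂ} {K : ℝ≥0}

instance : TopologicalSpace.SeparableSpace (L2 n) := by
  have : Fact ((2 : ℝ≥0∞) ≠ ∞) := ⟨ENNReal.ofNat_ne_top⟩
  have : SecondCountableTopology (L2 n) := inferInstance
  infer_instance

theorem aemeasurable_invWeight (hV : AEMeasurable V volume) : AEMeasurable (invWeight V) volume :=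
  hV.enorm.inv

/-- Only an inequality: where `V = 0` the left side is zero, since `0⁻¹ = 0` in `ℂ`, while the right
side may be `∞`. -/
theorem enorm_inv_root_mul_sq_le (x : EuclideanSpace ℝ (Fin n)) (c : ℂ) :
    ‖(((√‖V x‖ : ℝ) : ℂ))⁻¹ * c‖ₑ ^ 2 ≤ ‖c‖ₑ ^ 2 * invWeight V x := by
  by_cases h0 : V x = 0
  · simp [h0]
  · have h1 : ((√‖V x‖ : ℝ) : ℂ) ≠ 0 := by
      simpa [Real.sqrt_eq_zero (norm_nonneg _)] using h0
    rw [enorm_mul, mul_pow, enorm_inv h1, ← ENNReal.inv_pow, enorm_root_sq, mul_comm]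
    exact le_rfl

/-- A forcing term in `L²_{t,x}(|V|⁻¹)` is `|V|^{1/2} g` with `g ∈ L²(ℝ; L²(ℝⁿ))`. -/
theorem exists_eq_root_mul (hV : AEMeasurable V volume)
    {F : ℝ → EuclideanSpace ℝ (Fin n) → ℂ}
    (hF : AEStronglyMeasurable (Function.uncurry F) (volume.prod volume))
    (hfin : spaceTimeNorm (invWeight V) F < ∞) :
    ∃ g : ℝ → L2 n, MemLp g 2 ∧ eLpNorm g 2 volume ≤ spaceTimeNorm (invWeight V) F ∧
      ∀ᵐ s : ℝ, F s =ᵐ[volume] fun x => ((√‖V x‖ : ℝ) : ℂ) * g s x := by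
  classical
  set h : ℝ → EuclideanSpace ℝ (Fin n) → ℂ := fun s x => (((√‖V x‖ : ℝ) : ℂ))⁻¹ * F s x with hh
  have hroot : AEMeasurable (fun x => (((√‖V x‖ : ℝ) : ℂ))⁻¹) volume :=
    (Complex.measurable_ofReal.comp_aemeasurable
      (Real.continuous_sqrt.measurable.comp_aemeasurable hV.norm)).inv
  have hm : AEStronglyMeasurable (Function.uncurry h) (volume.prod volume) :=
    hroot.aestronglyMeasurable.comp_snd.mul hF
  have hslice : ∀ᵐ s : ℝ, AEStronglyMeasurable (h s) volume := hm.prodMk_left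
  have hsliceF : ∀ᵐ s : ℝ, AEStronglyMeasurable (F s) volume := hF.prodMk_left
  have hw : AEMeasurable fun s => weightedNorm (invWeight V) (F s) ^ 2 := by
    simp_rw [weightedNorm_sq]
    exact AEMeasurable.lintegral_prod_right'
      ((hF.enorm.pow_const 2).mul (aemeasurable_invWeight hV).comp_snd)
  have hfin2 : ∫⁻ s, weightedNorm (invWeight V) (F s) ^ 2 ≠ ∞ := by
    rw [← spaceTimeNorm_sq]
    exact (sq_lt_top_iff.2 hfin).ne
  have hwfin : ∀ᵐ s : ℝ, weightedNorm (invWeight V) (F s) ^ 2 < ∞ := ae_lt_top' hw hfin2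
  have hle : ∀ s, eLpNorm (h s) 2 volume ^ 2 ≤ weightedNorm (invWeight V) (F s) ^ 2 := by
    intro s
    rw [eLpNorm_two_sq, weightedNorm_sq]
    exact lintegral_mono fun x => enorm_inv_root_mul_sq_le x _
  have hmem : ∀ᵐ s : ℝ, MemLp (h s) 2 volume := by
    filter_upwards [hslice, hwfin] with s h1 h2
    exact ⟨h1, sq_lt_top_iff.1 ((hle s).trans_lt h2)⟩
  set g : ℝ → L2 n := fun s => if hs : MemLp (h s) 2 volume then hs.toLp (h s) else 0 with hg
  have hgh : ∀ᵐ s : ℝ, g s =ᵐ[volume] h s := by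
    filter_upwards [hmem] with s hs
    simp only [hg, dif_pos hs]
    exact hs.coeFn_toLp
  -- Pairings with a fixed `y` are measurable in `s` by Fubini, and in the separable space `L²` this
  -- suffices.
  have hgm : AEStronglyMeasurable g volume := by
    refine aestronglyMeasurable_of_inner fun y => ?_
    have h1 : AEStronglyMeasurable (fun s => ∫ x, h s x * conj (y x)) volume :=
      AEStronglyMeasurable.integral_prod_right' (f := fun p : ℝ × EuclideanSpace ℝ (Fin n) =>
        h p.1 p.2 * conj (y p.2))
        (hm.mul (RCLike.continuous_conj.comp_aestronglyMeasurable
          (Lp.aestronglyMeasurable y)).comp_snd)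
    refine h1.congr ?_
    filter_upwards [hgh] with s hs
    rw [L2.inner_def]
    refine integral_congr_ae ?_
    filter_upwards [hs] with x hx
    rw [hx, RCLike.inner_apply]
  have hgn : eLpNorm g 2 volume ≤ spaceTimeNorm (invWeight V) F := by
    rw [← ENNReal.pow_le_pow_left_iff two_ne_zero, eLpNorm_two_sq, spaceTimeNorm_sq]
    refine lintegral_mono_ae ?_
    filter_upwards [hgh] with s hs
    rw [Lp.enorm_def, eLpNorm_congr_ae hs]
    exact hle s
  refine ⟨g, ⟨hgm, hgn.trans_lt hfin⟩, hgn, ?_⟩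
  filter_upwards [hgh, hwfin, hsliceF] with s hs h2 h3
  rw [weightedNorm_sq] at h2
  have h4 := ae_lt_top' ((h3.enorm.pow_const 2).mul (aemeasurable_invWeight hV)) h2.ne
  filter_upwards [hs, h4] with x hx hx4
  rw [hx]
  simp only [hh]
  -- Where `V = 0` the weight is `∞`, so finiteness of the norm forces `F s x = 0` and the
  -- factorisation still holds.
  by_cases h0 : V x = 0
  · have hF0 : F s x = 0 := by
      by_contra hne
      simp [invWeight, h0, ENNReal.mul_top, hne] at hx4
    simp [hF0]
  · have h1 : ((√‖V x‖ : ℝ) : ℂ) ≠ 0 := by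
      simpa [Real.sqrt_eq_zero (norm_nonneg _)] using h0
    rw [mul_inv_cancel_left₀ h1]

theorem propagatorPairing_eq_rootPairing {F : ℝ → EuclideanSpace ℝ (Fin n) → ℂ} {g : ℝ → L2 n}
    {s : ℝ} (hs : F s =ᵐ[volume] fun x => ((√‖V x‖ : ℝ) : ℂ) * g s x) (f : L2 n) :
    propagatorPairing (-s) (F s) f = rootPairing V g f s := by
  rw [propagatorPairing, rootPairing, neg_neg]
  refine integral_congr_ae ?_
  filter_upwards [hs] with x hx
  rw [hx]

theorem UniformResolventEstimate.exists_isPropagatorIntegral (hK : UniformResolventEstimate V K)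
    (hV : AEMeasurable V volume) {F : ℝ → EuclideanSpace ℝ (Fin n) → ℂ}
    (hF : AEStronglyMeasurable (Function.uncurry F) (volume.prod volume))
    (hfin : spaceTimeNorm (invWeight V) F < ∞) :
    ∃ u : L2 n, IsPropagatorIntegral F u ∧
      ‖u‖ₑ ^ 2 ≤ 2 * K * spaceTimeNorm (invWeight V) F ^ 2 := by
  obtain ⟨g, hg, hgn, hFg⟩ := exists_eq_root_mul hV hF hfin
  obtain ⟨u, hu, hu'⟩ := hK.exists_integral hV hg
  refine ⟨u, fun f => ?_, hu.trans (by gcongr)⟩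
  have hP : (fun s => rootPairing V g f s) =ᵐ[volume] fun s => propagatorPairing (-s) (F s) f := by
    filter_upwards [hFg] with s hs
    exact (propagatorPairing_eq_rootPairing hs f).symm
  refine ⟨?_, (hK.integrable_rootPairing hV hg f).congr hP, ?_⟩
  · filter_upwards [hFg, hK.ae_weightedNorm_lt_top hV f] with s hs hw
    refine (integrable_root_mul_conj hV (g s) hw).congr ?_
    filter_upwards [hs] with x hx
    rw [hx]
  · rw [hu']
    exact integral_congr_ae hP

/-- The integral over `[0, t]` is the integral over `ℝ` of the forcing term cut off in time. -/
theorem IsPropagatorIntegral.isRetardedIntegral {F : ℝ → EuclideanSpace ℝ (Fin n) → ℂ} {t : ℝ}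
    {v : L2 n} (hv : IsPropagatorIntegral ((uIoc 0 t).indicator F) v) :
    IsRetardedIntegral F t ((if 0 ≤ t then (1 : ℝ) else -1 : ℝ) • propagator t v) := by
  intro f
  obtain ⟨h1, h2, h3⟩ := hv (propagator (-t) f)
  have hpair : (fun s => propagatorPairing (-s) ((uIoc 0 t).indicator F s) (propagator (-t) f)) =
      (uIoc 0 t).indicator fun s => propagatorPairing (t - s) (F s) f := by
    ext s
    by_cases hs : s ∈ uIoc 0 t
    · rw [indicator_of_mem hs, indicator_of_mem hs, propagatorPairing, propagatorPairing,
        propagator_propagator]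
      congr 1
      ext x
      rw [neg_neg, neg_sub, sub_eq_add_neg]
    · rw [indicator_of_notMem hs, indicator_of_notMem hs, propagatorPairing]
      simp
  rw [hpair] at h2 h3
  refine ⟨?_, ?_, ?_⟩
  · filter_upwards [h1] with s hs hst
    rw [indicator_of_mem hst, propagator_propagator] at hs
    exact hs
  · rw [intervalIntegrable_iff]
    exact (integrable_indicator_iff measurableSet_uIoc).1 h2
  · rw [integral_indicator measurableSet_uIoc] at h3
    rw [intervalIntegral.intervalIntegral_eq_integral_uIoc, ← h3, inner_smul_right_eq_smul]
    congr 1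
    rw [← schrodingerGroup_apply, ← schrodingerGroup_apply, IsometryGroup.inner_apply_left, neg_neg]

theorem IsRetardedIntegral.inner_eq {F : ℝ → EuclideanSpace ℝ (Fin n) → ℂ} {t : ℝ} {u : L2 n}
    (hu : IsRetardedIntegral F t u) {g : ℝ → L2 n}
    (hFg : ∀ᵐ s : ℝ, F s =ᵐ[volume] fun x => ((√‖V x‖ : ℝ) : ℂ) * g s x) (f : L2 n) :
    inner ℂ f u = ∫ s in (0 : ℝ)..t, rootPairing V g (propagator (-t) f) s := by
  rw [(hu f).2.2]
  refine intervalIntegral.integral_congr_ae ?_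
  filter_upwards [hFg] with s hs _
  rw [← propagatorPairing_eq_rootPairing hs, propagatorPairing, propagatorPairing,
    propagator_propagator]
  congr 1
  ext x
  rw [neg_neg, neg_sub, sub_eq_add_neg]

/-- Moving the group onto the test vector turns both sides into integrals over `uIoc 0 t` along the
orbit of `propagator (-t) f`, where `tendsto_setIntegral` applies. -/
theorem UniformResolventEstimate.tendsto_inner_duhamel (hK : UniformResolventEstimate V K)
    (hV : AEMeasurable V volume) {F : ℝ → EuclideanSpace ℝ (Fin n) → ℂ} {t : ℝ} {u : L2 n}
    (hu : IsRetardedIntegral F t u) {g : ℝ → L2 n} (hg : MemLp g 2)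
    (hFg : ∀ᵐ s : ℝ, F s =ᵐ[volume] fun x => ((√‖V x‖ : ℝ) : ℂ) * g s x) (f : L2 n) :
    Tendsto (fun k => inner ℂ f
      (duhamel (schrodingerGroup n) (cutoffOp hV k) (timeCutoff k g) t)) atTop
      (𝓝 (inner ℂ f u)) := by
  rw [hu.inner_eq hFg]
  simp_rw [inner_duhamel _ _ (integrable_timeCutoff _ hg), schrodingerGroup_apply,
    intervalIntegral.intervalIntegral_eq_integral_uIoc]
  exact (hK.tendsto_setIntegral hV hg _ _).const_smul _

/-- The retarded smoothing estimate. -/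
theorem UniformResolventEstimate.exists_isRetardedIntegral (hK : UniformResolventEstimate V K)
    (hV : AEMeasurable V volume) {F : ℝ → EuclideanSpace ℝ (Fin n) → ℂ}
    (hF : AEStronglyMeasurable (Function.uncurry F) (volume.prod volume))
    (hfin : spaceTimeNorm (invWeight V) F < ∞) :
    ∃ u : ℝ → L2 n, (∀ t : ℝ, IsRetardedIntegral F t (u t)) ∧ AEStronglyMeasurable u volume ∧
      spaceTimeNorm (absWeight V) (fun t => u t) ≤ 2 * K * spaceTimeNorm (invWeight V) F := by
  -- For each single `t` the dual estimate already provides the integral; cutting the forcing in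
  -- time does not increase its norm.
  have hcut : ∀ t : ℝ, ∃ v : L2 n, IsPropagatorIntegral ((uIoc 0 t).indicator F) v := by
    intro t
    have hind : Function.uncurry ((uIoc 0 t).indicator F) =
        (Prod.fst ⁻¹' uIoc 0 t).indicator (Function.uncurry F) := by
      ext ⟨s, x⟩
      by_cases hs : s ∈ uIoc 0 t <;> simp [Function.uncurry, indicator, hs]
    obtain ⟨v, hv, -⟩ := hK.exists_isPropagatorIntegral hV (F := (uIoc 0 t).indicator F)
      (by rw [hind]; exact hF.indicator (measurable_fst measurableSet_uIoc)) (by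
        rw [← sq_lt_top_iff, spaceTimeNorm_sq]
        rw [← sq_lt_top_iff, spaceTimeNorm_sq] at hfin
        refine (lintegral_mono fun s => ?_).trans_lt hfin
        rw [weightedNorm_sq, weightedNorm_sq]
        refine lintegral_mono fun x => ?_
        by_cases hs : s ∈ uIoc 0 t <;> simp [hs])
    exact ⟨v, hv⟩
  choose v hv using hcut
  set u : ℝ → L2 n := fun t => (if 0 ≤ t then (1 : ℝ) else -1 : ℝ) • propagator t (v t) with hu
  have hret : ∀ t, IsRetardedIntegral F t (u t) := fun t => (hv t).isRetardedIntegral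
  obtain ⟨g, hg, hgn, hFg⟩ := exists_eq_root_mul hV hF hfin
  set w : ℕ → ℝ → L2 n := fun k =>
    duhamel (schrodingerGroup n) (cutoffOp hV k) (timeCutoff k g) with hw
  have hwc : ∀ k, Continuous (w k) := fun k =>
    continuous_duhamel _ _ (integrable_timeCutoff k hg)
  have hlim : ∀ t f, Tendsto (fun k => inner ℂ f (w k t)) atTop (𝓝 (inner ℂ f (u t))) :=
    fun t f => hK.tendsto_inner_duhamel hV (hret t) hg hFg f
  refine ⟨u, hret, ?_, ?_⟩
  · refine aestronglyMeasurable_of_inner fun y => ?_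
    exact aestronglyMeasurable_of_tendsto_ae atTop
      (fun k => (continuous_const.inner (hwc k)).aestronglyMeasurable)
      (Eventually.of_forall fun t => hlim t y)
  -- For fixed `m`, `cutoffOp hV m (w k t)` converges weakly as `k → ∞`. Lower semicontinuity
  -- applies, and for `k ≥ m` the truncation at `m` is dominated by that at `k`.
  · have hlsc : ∀ t, weightedNorm (absWeight V) (u t) ^ 2 ≤
        liminf (fun k => ‖cutoffOp hV k (w k t)‖ₑ ^ 2) atTop := by
      intro t
      rw [weightedNorm_sq_eq_iSup hV]
      refine iSup_le fun m => ?_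
      refine (enorm_sq_le_liminf (x := fun k => cutoffOp hV m (w k t)) ?_).trans ?_
      · simp_rw [← inner_cutoffOp hV m]
        rw [inner_cutoffOp hV m, ← inner_cutoffOp hV m]
        exact hlim t _
      · refine liminf_le_liminf ?_
        filter_upwards [eventually_ge_atTop m] with k hk
        gcongr
        exact enorm_cutoffOp_mono hV hk _
    have hk : ∀ k, ∫⁻ t, ‖cutoffOp hV k (w k t)‖ₑ ^ 2 ≤
        (2 * K * spaceTimeNorm (invWeight V) F) ^ 2 := by
      intro k
      rw [← eLpNorm_two_sq]
      gcongr
      refine ((hK.supersmooth hV k).eLpNorm_duhamel (hK.supersmooth_reverse hV k)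
        (integrable_timeCutoff k hg) (memLp_timeCutoff k hg)).trans ?_
      gcongr
      exact (eLpNorm_timeCutoff_le k g).trans hgn
    rw [← ENNReal.pow_le_pow_left_iff two_ne_zero, spaceTimeNorm_sq]
    calc ∫⁻ t, weightedNorm (absWeight V) (u t) ^ 2
        ≤ ∫⁻ t, liminf (fun k => ‖cutoffOp hV k (w k t)‖ₑ ^ 2) atTop := lintegral_mono hlsc
      _ ≤ liminf (fun k => ∫⁻ t, ‖cutoffOp hV k (w k t)‖ₑ ^ 2) atTop :=
          lintegral_liminf_le fun k =>
            ((cutoffOp hV k).continuous.comp (hwc k)).enorm.measurable.pow_const 2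
      _ ≤ liminf (fun _ => (2 * K * spaceTimeNorm (invWeight V) F) ^ 2) atTop :=
          liminf_le_liminf (Eventually.of_forall hk)
      _ = _ := by simp

/-- The natural constant `√2` is rounded up to 2, the constant of the retarded estimate, so that one
constant serves all three. -/
theorem le_two_mul_sqrt_mul {a b : ℝ≥0∞} (h : a ^ 2 ≤ 2 * K * b ^ 2) :
    a ≤ 2 * (NNReal.sqrt K : ℝ≥0∞) * b := by
  rw [← ENNReal.pow_le_pow_left_iff two_ne_zero, mul_pow, mul_pow, ← ENNReal.coe_pow,
    NNReal.sq_sqrt]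
  refine h.trans ?_
  gcongr
  norm_num

end

end WeightedStrichartz

end

theorem mainTheorem12 (n : ℕ) (hn : 2 ≤ n) :
    ∃ C : ℝ≥0, ∀ V : EuclideanSpace ℝ (Fin n) → ℂ, AEMeasurable V volume →
      ∀ K : ℝ≥0, UniformResolventEstimate V K →
        (∀ f : L2 n,
          AEStronglyMeasurable (fun t : ℝ => propagator t f) volume ∧
          spaceTimeNorm (absWeight V) (fun t => propagator t f) ≤
            C * (NNReal.sqrt K : ℝ≥0∞) * ‖f‖ₑ) ∧
        (∀ F : ℝ → EuclideanSpace ℝ (Fin n) → ℂ,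
          AEStronglyMeasurable (Function.uncurry F) (volume.prod volume) →
          spaceTimeNorm (invWeight V) F < ∞ →
            ∃ u : L2 n, IsPropagatorIntegral F u ∧
              ‖u‖ₑ ≤ C * (NNReal.sqrt K : ℝ≥0∞) * spaceTimeNorm (invWeight V) F) ∧
        (∀ F : ℝ → EuclideanSpace ℝ (Fin n) → ℂ,
          AEStronglyMeasurable (Function.uncurry F) (volume.prod volume) →
          spaceTimeNorm (invWeight V) F < ∞ →
            ∃ u : ℝ → L2 n, (∀ t : ℝ, IsRetardedIntegral F t (u t)) ∧
              AEStronglyMeasurable u volume ∧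
              spaceTimeNorm (absWeight V) (fun t => u t) ≤
                C * (K : ℝ≥0∞) * spaceTimeNorm (invWeight V) F) := by
  refine ⟨2, fun V hV K hK => ⟨fun f => ⟨(continuous_propagator f).aestronglyMeasurable,
    le_two_mul_sqrt_mul (hK.spaceTimeNorm_propagator_sq hV f)⟩, fun F hF hfin => ?_,
    fun F hF hfin => hK.exists_isRetardedIntegral hV hF hfin⟩⟩
  obtain ⟨u, hu, hle⟩ := hK.exists_isPropagatorIntegral hV hF hfin
  exact ⟨u, hu, le_two_mul_sqrt_mul hle⟩
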